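/- **Setting.** Fix a relation symbol $R$ of arity $n\ge 1$ whose first $l\le n$ positions form its primary key, and an infinite domain of elements. A *fact* is $R(\bar t)$ with $\bar t$ an $n$-tuple of elements, an *atom* is $R(\bar t)$ with $\bar t$ an $n$-tuple of variables. For a term $t$, $\overline{\mathrm{key}}(t)$ is the tuple of its first $l$ entries, $\mathrm{key}(t)$ the set of entries of this tuple, and $\mathrm{vars}(t)$ the set of all entries of $t$. We write $t\sim t'$ (key-equal) if $\overline{\mathrm{key}}(t)=\overline{\mathrm{key}}(t')$. A *database* is a finite set of facts; its *blocks* are its $\sim$-classes; it is *consistent* if it has no two distinct key-equal facts; a *repair* of $D$ is a $\subseteq$-maximal consistent subset of $D$. A *query* $q=AB$ is a pair of atoms, standing for the Boolean query $\exists\bar y\; A\wedge B$ with $\bar y$ all the variables. For facts $a,b$ we write $q(ab)$ if some map $\mu$ from variables to elements satisfies $\mu(A)=a$ and $\mu(B)=b$; $q\{ab\}$ means $q(ab)$ or $q(ba)$; and $D\models q$ means that $q(ab)$ for some $a,b\in D$. Let $\mathrm{certain}(q)$ be the set of databases all of whose repairs satisfy $q$. The query $q=AB$ is *2way-determined* if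 $\mathrm{key}(A)\not\subseteq\mathrm{key}(B)$, $\mathrm{key}(B)\not\subseteq\mathrm{key}(A)$, $\mathrm{key}(A)\subseteq\mathrm{vars}(B)$ and $\mathrm{key}(B)\subseteq\mathrm{vars}(A)$. **Greedy fixpoint algorithm.** A *$k$-set* of $D$ is a consistent $S\subseteq D$ with $|S|\le k$. Let $\Delta_k(q,D)$ be the least family of $k$-sets of $D$ which contains every $k$-set $S$ with $S\models q$, and which contains a $k$-set $S$ whenever there is a block $B$ of $D$ such that for every $u\in B$ some $S'\subseteq S\cup\{u\}$ lies in $\Delta_k(q,D)$. Let $\mathrm{Cert}_k(q)$ be the set of databases $D$ with $\emptyset\in\Delta_k(q,D)$. **Tripaths.** For facts $d,e,f$ with $q(de)$ and $q(ef)$, let $g(e)$ be the set of entries of the tuple given by the first applicable case: $\overline{\mathrm{key}}(d)$ if $\mathrm{key}(d)\subseteq\mathrm{key}(e)$ and $\mathrm{key}(f)\not\subseteq\mathrm{key}(e)$; $\overline{\mathrm{key}}(f)$ if $\mathrm{key}(d)\not\subseteq\mathrm{key}(e)$ and $\mathrm{key}(f)\subseteq\mathrm{key}(e)$; $\overline{\mathrm{key}}(d)$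 if $\mathrm{key}(d)\subseteq\mathrm{key}(f)\subseteq\mathrm{key}(e)$; $\overline{\mathrm{key}}(f)$ if $\mathrm{key}(f)\subseteq\mathrm{key}(d)\subseteq\mathrm{key}(e)$; $\overline{\mathrm{key}}(e)$ otherwise. A *tripath* of $q$ is a database $\Theta$ whose blocks can be arranged as a rooted tree with exactly two leaves (hence exactly one block, the branching block, has two children) such that: - the root block $B_0$ consists of one fact $a(B_0)$, each leaf block $B_1,B_2$ consists of one fact $b(B_1)$, $b(B_2)$ respectively, and every other block $B$ consists of exactly two facts $a(B)\ne b(B)$; - whenever $B$ is the parent of $B'$, $q\{a(B)\,b(B')\}$ holds; in particular, if $B$ is the branching block and $e=a(B)$, its two children can be named $B',B''$ so that $d=b(B')$ and $f=b(B'')$ satisfy $q(de)$ and $q(ef)$; - with these $d,e,f$, $g(e)$ is contained in none of $\mathrm{key}(a(B_0))$, $\mathrm{key}(b(B_1))$, $\mathrm{key}(b(B_2))$. It is a *triangle-tripath* if moreover $q(fd)$ holds. The query $q$ *admits* a triangle-tripath if some database contains one as a subset. **Theorem.** Let $q$ be a 2way-determined query admitting a triangle-tripath. Then for every natural number $k$,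 $\mathrm{certain}(q)\neq\mathrm{Cert}_k(q)$. -/

import Mathlib

/-- A schema with one relation symbol of signature `[arity, keyLen]`:
the first `keyLen` positions form the primary key. -/
structure Schema where
  arity : ℕ
  keyLen : ℕ
  one_le_arity : 1 ≤ arity
  keyLen_le : keyLen ≤ arity

namespace Schema

/-- A term `R(t)` over `T`: an atom if `T` is the set of variables,
a fact if `T` is the domain of elements. -/
abbrev Term (σ : Schema) (T : Type*) := Fin σ.arity → T

variable {σ : Schema}

/-- The key of a term, as a tuple. -/
def keyTuple {T : Type*} (t : σ.Term T) : Fin σ.keyLen → T :=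
  fun i => t (Fin.castLE σ.keyLen_le i)

/-- The key of a term, as a set. -/
def key {T : Type*} (t : σ.Term T) : Set T := Set.range (keyTuple t)

/-- The set of variables of an atom (active domain of a fact). -/
def vars {T : Type*} (t : σ.Term T) : Set T := Set.range t

/-- Key-equality `t ∼ t'`. -/
def KeyEq {T : Type*} (t t' : σ.Term T) : Prop := keyTuple t = keyTuple t'

/-- A database is a finite set of facts. -/
abbrev Database (σ : Schema) (E : Type*) := Finset (σ.Term E)

/-- A database is consistent if it has no two distinct key-equal facts. -/
def Consistent {E : Type*} (D : σ.Database E) : Prop :=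
  ∀ a ∈ D, ∀ b ∈ D, KeyEq a b → a = b

/-- The blocks of `D`: the classes of facts of `D` for key-equality. -/
def blocks {E : Type*} (D : σ.Database E) : Set (Set (σ.Term E)) :=
  {B | ∃ a ∈ D, B = {c | c ∈ D ∧ KeyEq c a}}

/-- The type of blocks of `D`. -/
abbrev Block {E : Type*} (D : σ.Database E) := {B : Set (σ.Term E) // B ∈ blocks D}

/-- A repair is a `⊆`-maximal consistent subset. -/
def IsRepair {E : Type*} (D r : σ.Database E) : Prop :=
  Maximal (fun s : σ.Database E => s ⊆ D ∧ Consistent s) r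

end Schema

open Schema

/-- A Boolean two-atom query `∃ ȳ, A ∧ B`, written `q = AB`. -/
structure TwoAtomQuery (σ : Schema) (V : Type*) where
  A : σ.Term V
  B : σ.Term V

namespace TwoAtomQuery

variable {σ : Schema} {V : Type*}

/-- `q(ab)`: some assignment of the variables maps `A` to `a` and `B` to `b`. -/
def Sol {E : Type*} (q : TwoAtomQuery σ V) (a b : σ.Term E) : Prop :=
  ∃ μ : V → E, μ ∘ q.A = a ∧ μ ∘ q.B = b

/-- `q{ab}`: `q(ab)` or `q(ba)`. -/
def SymSol {E : Type*} (q : TwoAtomQuery σ V) (a b : σ.Term E) : Prop :=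
  q.Sol a b ∨ q.Sol b a

/-- `D ⊨ q`. -/
def Sat {E : Type*} (q : TwoAtomQuery σ V) (D : σ.Database E) : Prop :=
  ∃ a ∈ D, ∃ b ∈ D, q.Sol a b

/-- `certain(q)`: the databases all of whose repairs satisfy `q`. -/
def certain (q : TwoAtomQuery σ V) (E : Type*) : Set (σ.Database E) :=
  {D | ∀ r, IsRepair D r → q.Sat r}

/-- A `k`-set of `D`: at most `k` facts of `D`, at most one from every block. -/
def IsKSet {E : Type*} (k : ℕ) (D S : σ.Database E) : Prop :=
  S ⊆ D ∧ S.card ≤ k ∧ Consistent S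

/-- `Δ_k(q, D)`: the least family of `k`-sets of `D` that contains the `k`-sets satisfying `q` and
contains a `k`-set `S` as soon as there is a block `B` of `D` such that for every `u ∈ B` some
`S' u ⊆ S ∪ {u}` is in the family. -/
inductive Delta {E : Type*} (q : TwoAtomQuery σ V) (k : ℕ) (D : σ.Database E) :
    σ.Database E → Prop
  | init (S : σ.Database E) (hS : IsKSet k D S) (hq : q.Sat S) : Delta q k D S
  | step (S : σ.Database E) (hS : IsKSet k D S) (B : Set (σ.Term E)) (hB : B ∈ blocks D)
      (S' : σ.Term E → σ.Database E)
      (hsub : ∀ u ∈ B, (S' u : Set (σ.Term E)) ⊆ (S : Set (σ.Term E)) ∪ {u})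
      (hmem : ∀ u ∈ B, Delta q k D (S' u)) : Delta q k D S

/-- `Cert_k(q)`: the databases on which the greedy fixpoint algorithm answers yes. -/
def Cert (k : ℕ) (q : TwoAtomQuery σ V) (E : Type*) : Set (σ.Database E) :=
  {D | Delta q k D ∅}

/-- 2way-determined queries. -/
def TwoWayDetermined (q : TwoAtomQuery σ V) : Prop :=
  ¬ key q.A ⊆ key q.B ∧ ¬ key q.B ⊆ key q.A ∧ key q.A ⊆ vars q.B ∧ key q.B ⊆ vars q.A

end TwoAtomQuery

open Classical in
/-- The tuple `𝐠(e)` for a fact `e` that is branching with `d` and `f`. (If both inclusions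
`key d ⊆ key f ⊆ key e` and `key f ⊆ key d ⊆ key e` hold, the two possible tuples have the same
set of entries, and only this set is used.) -/
noncomputable def gTuple {σ : Schema} {E : Type*} (d e f : σ.Term E) : Fin σ.keyLen → E :=
  if key d ⊆ key e ∧ ¬ key f ⊆ key e then keyTuple d
  else if ¬ key d ⊆ key e ∧ key f ⊆ key e then keyTuple f
  else if key d ⊆ key f ∧ key f ⊆ key e then keyTuple d
  else if key f ⊆ key d ∧ key d ⊆ key e then keyTuple f
  else keyTuple e

/-- The set `g(e)` of elements occurring in the tuple `𝐠(e)`. -/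
noncomputable def gSet {σ : Schema} {E : Type*} (d e f : σ.Term E) : Set E :=
  Set.range (gTuple d e f)

/-- A tripath structure of `q` on the database `Θ`. -/
structure Tripath {σ : Schema} {V : Type*} (q : TwoAtomQuery σ V) {E : Type*}
    (Θ : σ.Database E) where
  /-- the parent function between the blocks (undefined is `none`) -/
  parent : Block Θ → Option (Block Θ)
  /-- the root block -/
  root : Block Θ
  /-- the two leaf blocks -/
  leaf₁ : Block Θ
  leaf₂ : Block Θ
  parent_eq_none_iff : ∀ B, parent B = none ↔ B = root
  /-- the root is reached from every block, so that the blocks form a rooted tree -/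
  reaches_root : ∀ B, Relation.ReflTransGen (fun C C' => parent C = some C') B root
  leaf_ne : leaf₁ ≠ leaf₂
  /-- the leaf blocks are exactly the blocks without children -/
  isLeaf_iff : ∀ B, (∀ B', parent B' ≠ some B) ↔ (B = leaf₁ ∨ B = leaf₂)
  /-- the facts `a(B)` (irrelevant if `B` is a leaf) and `b(B)` (irrelevant if `B` is the root) -/
  a : Block Θ → σ.Term E
  b : Block Θ → σ.Term E
  root_eq : (root : Set (σ.Term E)) = {a root}
  leaf₁_eq : (leaf₁ : Set (σ.Term E)) = {b leaf₁}
  leaf₂_eq : (leaf₂ : Set (σ.Term E)) = {b leaf₂}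
  block_eq : ∀ B, B ≠ root → B ≠ leaf₁ → B ≠ leaf₂ →
    a B ≠ b B ∧ (B : Set (σ.Term E)) = {a B, b B}
  edge_sol : ∀ B B', parent B' = some B → q.SymSol (a B) (b B')
  /-- the branching block and its two children, ordered so that the facts
  `d = b(child₁)`, `e = a(center)`, `f = b(child₂)` satisfy `q(de)` and `q(ef)` -/
  center : Block Θ
  child₁ : Block Θ
  child₂ : Block Θ
  child_ne : child₁ ≠ child₂
  parent_child₁ : parent child₁ = some center
  parent_child₂ : parent child₂ = some center
  sol_de : q.Sol (b child₁) (a center)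
  sol_ef : q.Sol (a center) (b child₂)
  g_root : ¬ gSet (b child₁) (a center) (b child₂) ⊆ key (a root)
  g_leaf₁ : ¬ gSet (b child₁) (a center) (b child₂) ⊆ key (b leaf₁)
  g_leaf₂ : ¬ gSet (b child₁) (a center) (b child₂) ⊆ key (b leaf₂)

/-- A triangle-tripath: the center `def` also satisfies `q(fd)`. -/
def Tripath.IsTriangle {σ : Schema} {V : Type*} {q : TwoAtomQuery σ V} {E : Type*}
    {Θ : σ.Database E} (T : Tripath q Θ) : Prop :=
  q.Sol (T.b T.child₂) (T.b T.child₁)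

/-- `q` admits a triangle-tripath: some database contains one. -/
def TwoAtomQuery.AdmitsTriangleTripath {σ : Schema} {V : Type*} (q : TwoAtomQuery σ V)
    (E : Type*) : Prop :=
  ∃ D Θ : σ.Database E, Θ ⊆ D ∧ ∃ T : Tripath q Θ, T.IsTriangle

/-! The greedy algorithm handles at most $k$ facts at a time, so it cannot see a pigeonhole
contradiction with many holes. The triangle makes it possible to encode one as a database.

The encoding is by a `Gadget` with three tips: a choice of facts without solution exists with any
single tip, but never with two. Copies are indexed by a hole and a pigeon. Gluing the tips 0 over
all holes says that each pigeon sits somewhere. The tips 1 and 2 alternately link the copies in one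
hole to a path with one link fewer than copies. Every link uses up a copy, so at most one copy per
hole is left for a pigeon, and every repair satisfies $q$ (`Gadget.db_mem_certain`). On the other
hand, at most $k$ facts touch at most $k$ holes, and a partial placement of pigeons explaining them
can be changed elsewhere to answer any further block (`Gadget.Good.exists_mem`).

To build a gadget, attach to the three blocks of the triangle rotated copies of an alternating path,
an `Arm`. Choosing the tip of an arm forces the triangle fact at its other end, and two triangle
facts form a solution. Facts are triangle facts with labels, where label zero marks what the arms
share. The triangle is taken over triples of elements so that it has a rotational symmetry. An arm
must have no unwanted solutions, and the key of its tip must not contain the key of an inner block.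

Unwanted solutions are removed in `Walk.arm`: each edge of a chordless walk of labelled keys is
traversed forth, back and forth with fresh labels. As $q$ is 2way-determined, a fact determines the
key of its partner, and the fresh labels contradict any shortcut.

The walk has to lose an element of the triangle's key. If no key survives a single step, one step is
enough. Otherwise the three keys have the same elements and $g(e)$ is this set. The path of the
tripath from the branching block to the root then loses one of them (`Tripath.exists_lost`), and a
shortest path to such a loss is chordless. -/

namespace Schema

variable {σ : Schema} {E : Type*}

/-- Every block meets every repair. -/
theorem IsRepair.exists_keyEq {D r : σ.Database E} (h : IsRepair D r) {d : σ.Term E}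
    (hd : d ∈ D) : ∃ g ∈ r, KeyEq g d := by
  classical
  by_contra hc
  push Not at hc
  have hins : insert d r ⊆ r := by
    refine h.2 (y := insert d r) ⟨Finset.insert_subset hd h.1.1, ?_⟩ (Finset.subset_insert d r)
    intro a ha b hb hab
    rcases Finset.mem_insert.1 ha with ha' | ha' <;>
      rcases Finset.mem_insert.1 hb with hb' | hb'
    · rw [ha', hb']
    · exact absurd (Eq.symm (ha' ▸ hab)) (hc b hb')
    · exact absurd (hb' ▸ hab) (hc a ha')
    · exact h.1.2 a ha' b hb' hab
  exact hc d (hins (Finset.mem_insert_self d r)) rfl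

theorem key_congr {t t' : σ.Term E} (h : keyTuple t = keyTuple t') : key t = key t' := by
  simp [key, h]

end Schema

/-! ### Gadgets and the pigeonhole database -/

/-- A gadget of `q`: internal blocks with two facts each and three further facts, the tips, any
two of which exclude each other. -/
structure Gadget {σ : Schema} {V : Type*} (q : TwoAtomQuery σ V) (ι W : Type*) where
  fact : ι → Bool → σ.Term W
  tip : ZMod 3 → σ.Term W
  key_fact : ∀ i b, keyTuple (fact i b) = keyTuple (fact i true)
  key_inj : ∀ i j, keyTuple (fact i true) = keyTuple (fact j true) → i = j
  key_fact_tip : ∀ i x, ¬ key (fact i true) ⊆ key (tip x)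
  key_tip_tip : ∀ x y, x ≠ y → ¬ key (tip x) ⊆ key (tip y)
  blocked : ∀ (s : ι → Bool) (x y : ZMod 3), x ≠ y →
    ∃ f g, (f = tip x ∨ f = tip y ∨ ∃ i, f = fact i (s i)) ∧
      (g = tip x ∨ g = tip y ∨ ∃ i, g = fact i (s i)) ∧ q.Sol f g
  sel : ZMod 3 → ι → Bool
  free : ∀ x f g, (f = tip x ∨ ∃ i, f = fact i (sel x i)) →
    (g = tip x ∨ ∃ i, g = fact i (sel x i)) → ¬ q.Sol f g

namespace Gadget

variable {σ : Schema} {V ι W E : Type*} {q : TwoAtomQuery σ V} (G : Gadget q ι W)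

/-- The facts of a gadget. -/
def get : ι × Bool ⊕ ZMod 3 → σ.Term W
  | .inl a => G.fact a.1 a.2
  | .inr x => G.tip x

open Classical in
/-- The label of an element in the copy number `i` of the gadget for the hole `h`. -/
noncomputable def label (h i : ℕ) (x : W) : ℕ × ℕ × ℕ :=
  -- Tip 0 forgets the hole. Tip 1 forgets `(i + 1) / 2` and so is shared by the copies `2m` and `2m
  -- + 1`; tip 2 forgets `i / 2` and is shared by `2m - 1` and `2m`.
  (if x ∈ key (G.tip 0) then 0 else h, if x ∈ key (G.tip 2) then 0 else i / 2,
    if x ∈ key (G.tip 1) then 0 else (i + 1) / 2)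

/-- A fact in a copy of the gadget. -/
noncomputable def copy (emb : W × ℕ × ℕ × ℕ → E) (h i : ℕ) (a : ι × Bool ⊕ ZMod 3) : σ.Term E :=
  fun p => emb (G.get a p, G.label h i (G.get a p))

variable {G} {emb : W × ℕ × ℕ × ℕ → E}

/-- An element outside the key of a tip still records what that tip forgets. Since `i = i / 2 + (i +
1) / 2`, a set inside no tip key determines the copy. -/
theorem label_sep {h i h' i' : ℕ} {S : Set W}
    (hS : ∀ x ∈ S, G.label h i x = G.label h' i' x) :
    (¬ S ⊆ key (G.tip 0) → h = h') ∧ (¬ S ⊆ key (G.tip 2) → i / 2 = i' / 2) ∧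
      (¬ S ⊆ key (G.tip 1) → (i + 1) / 2 = (i' + 1) / 2) := by
  refine ⟨fun hn => ?_, fun hn => ?_, fun hn => ?_⟩ <;>
  · obtain ⟨x, hx, hxn⟩ := Set.not_subset.1 hn
    have := hS x hx
    simp only [label, Prod.mk.injEq, hxn, if_false] at this
    first | exact this.1 | exact this.2.1 | exact this.2.2

theorem keyEq_copy (hemb : Function.Injective emb) {h i h' i' : ℕ} {a a' : ι × Bool ⊕ ZMod 3} :
    keyTuple (G.copy emb h i a) = keyTuple (G.copy emb h' i' a') ↔
      keyTuple (G.get a) = keyTuple (G.get a') ∧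
        ∀ x ∈ key (G.get a), G.label h i x = G.label h' i' x := by
  constructor
  · intro hk
    have hp : ∀ p, _ := fun p => hemb (congrFun hk p)
    simp only [Prod.mk.injEq] at hp
    refine ⟨funext fun p => (hp p).1, ?_⟩
    rintro _ ⟨p, rfl⟩
    have h1 := (hp p).1
    have h2 := (hp p).2
    rw [← h1] at h2
    exact h2
  · rintro ⟨h1, h2⟩
    funext p
    have h3 : G.get a (Fin.castLE σ.keyLen_le p) = G.get a' (Fin.castLE σ.keyLen_le p) :=
      congrFun h1 p
    have h4 := h2 _ ⟨p, rfl⟩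
    simp only [keyTuple] at h4
    simp only [keyTuple, copy, ← h3, h4]

/-- Each key variable of one atom occurs in the other atom, so both copies label its value;
forgetting the labels preserves the solution. -/
theorem sol_copy (hemb : Function.Injective emb) (hdet : q.TwoWayDetermined) {h i h' i' : ℕ}
    {a a' : ι × Bool ⊕ ZMod 3} (hs : q.Sol (G.copy emb h i a) (G.copy emb h' i' a')) :
    q.Sol (G.get a) (G.get a') ∧
      ∀ x ∈ key (G.get a) ∪ key (G.get a'), G.label h i x = G.label h' i' x := by
  obtain ⟨μ, h1, h2⟩ := hs
  have hA : ∀ p, μ (q.A p) = emb (G.get a p, G.label h i (G.get a p)) := fun p => congrFun h1 p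
  have hB : ∀ p, μ (q.B p) = emb (G.get a' p, G.label h' i' (G.get a' p)) := fun p => congrFun h2 p
  have hAB : ∀ p p', q.A p = q.B p' →
      G.get a p = G.get a' p' ∧ G.label h i (G.get a p) = G.label h' i' (G.get a p) := by
    intro p p' hpp
    have := hA p
    rw [hpp, hB p'] at this
    have := hemb this
    simp only [Prod.mk.injEq] at this
    refine ⟨this.1.symm, ?_⟩
    rw [← this.2, this.1]
  refine ⟨?_, ?_⟩
  · by_cases hn : Nonempty (Fin σ.arity)
    · have hW : Nonempty (W × ℕ × ℕ × ℕ) := ⟨(G.get a hn.some, 0, 0, 0)⟩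
      refine ⟨fun v => (Function.invFun emb (μ v)).1, funext fun p => ?_, funext fun p => ?_⟩
      · simp [hA, Function.leftInverse_invFun hemb _]
      · simp [hB, Function.leftInverse_invFun hemb _]
    · exact absurd ⟨⟨0, σ.one_le_arity⟩⟩ hn
  · rintro x (⟨p, rfl⟩ | ⟨p, rfl⟩)
    · obtain ⟨p', hp'⟩ := hdet.2.2.1 ⟨p, rfl⟩
      exact (hAB _ p' hp'.symm).2
    · obtain ⟨p', hp'⟩ := hdet.2.2.2 ⟨p, rfl⟩
      have h3 := hAB p' _ hp'
      have h4 := h3.2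
      rw [h3.1] at h4
      exact h4

/-- The type of the link between the copies number `l - 1` and `l`. -/
def low (l : ℕ) : ZMod 3 := if l % 2 = 1 then 1 else 2

theorem low_ne_zero (l : ℕ) : low l ≠ 0 := by
  unfold low; split_ifs <;> decide

theorem low_succ_ne (l : ℕ) : low (l + 1) ≠ low l := by
  unfold low
  split_ifs
  · omega
  · decide
  · decide
  · omega

/-- The facts of a copy that belong to the database. -/
def Valid (k i : ℕ) (a : ι × Bool ⊕ ZMod 3) : Prop :=
  -- The number of copies in a hole is even, so tip 2 is without a neighbour at both ends of the
  -- path. Keeping these two facts would give more link blocks than copies.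
  a = .inr 2 → 0 < i ∧ i + 1 < 2 * k + 2

variable (G emb) in
open Classical in
/-- The pigeonhole database with `2k + 2` pigeons and `2k + 1` holes. -/
noncomputable def db [Fintype ι] (k : ℕ) : σ.Database E :=
  ((Finset.range (2 * k + 1) ×ˢ Finset.range (2 * k + 2) ×ˢ
    (Finset.univ : Finset (ι × Bool ⊕ ZMod 3))).filter fun c => Valid k c.2.1 c.2.2).image
      fun c => G.copy emb c.1 c.2.1 c.2.2

theorem mem_db [Fintype ι] {k : ℕ} {f : σ.Term E} : f ∈ G.db emb k ↔
    ∃ h i a, h < 2 * k + 1 ∧ i < 2 * k + 2 ∧ Valid k i a ∧ f = G.copy emb h i a := by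
  simp only [db, Finset.mem_image, Finset.mem_filter, Finset.mem_product, Finset.mem_range,
    Finset.mem_univ, and_true, Prod.exists]
  constructor
  · rintro ⟨h, i, a, ⟨⟨h1, h2⟩, h3⟩, rfl⟩
    exact ⟨h, i, a, h1, h2, h3, rfl⟩
  · rintro ⟨h, i, a, h1, h2, h3, rfl⟩
    exact ⟨h, i, a, ⟨⟨h1, h2⟩, h3⟩, rfl⟩

theorem valid_inl (k i : ℕ) (a : ι × Bool) : Valid k i (.inl a : ι × Bool ⊕ ZMod 3) :=
  fun h => by simp at h

theorem valid_zero (k i : ℕ) : Valid k i (.inr 0 : ι × Bool ⊕ ZMod 3) := fun h => by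
  rw [Sum.inr.injEq] at h
  exact absurd h (by decide)

theorem valid_low {k l : ℕ} (h0 : 0 < l) (hl : l < 2 * k + 2) :
    Valid k l (.inr (low l) : ι × Bool ⊕ ZMod 3) ∧
      Valid k (l - 1) (.inr (low l) : ι × Bool ⊕ ZMod 3) := by
  by_cases h : l % 2 = 1
  · simp only [low, h, if_true, Valid, Sum.inr.injEq]
    exact ⟨fun h => absurd h (by decide), fun h => absurd h (by decide)⟩
  · simp only [low, h, if_false, Valid, forall_const]
    omega

theorem keyEq_link (hemb : Function.Injective emb) (h : ℕ) {l : ℕ} (h0 : 0 < l) :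
    keyTuple (G.copy emb h (l - 1) (.inr (low l))) = keyTuple (G.copy emb h l (.inr (low l))) := by
  rw [keyEq_copy hemb]
  refine ⟨rfl, fun x hx => ?_⟩
  by_cases hl : l % 2 = 1
  · simp only [get, low, hl, if_true] at hx
    have : (l - 1) / 2 = l / 2 := by omega
    simp [label, hx, this]
  · simp only [get, low, hl, if_false] at hx
    have : (l - 1 + 1) / 2 = (l + 1) / 2 := by omega
    simp [label, hx, this]

theorem get_inl_keyEq {i : ι} {b : Bool} {a : ι × Bool ⊕ ZMod 3}
    (h : keyTuple (G.get a) = keyTuple (G.get (.inl (i, b)))) : ∃ b', a = .inl (i, b') := by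
  rcases a with ⟨j, c⟩ | x
  · simp only [get, G.key_fact] at h
    exact ⟨c, by rw [G.key_inj _ _ h]⟩
  · refine absurd ?_ (G.key_fact_tip i x)
    simp only [get, G.key_fact] at h
    exact (key_congr h).ge

theorem get_inr_keyEq {x : ZMod 3} {a : ι × Bool ⊕ ZMod 3}
    (h : keyTuple (G.get a) = keyTuple (G.get (.inr x))) : a = .inr x := by
  rcases a with ⟨j, c⟩ | y
  · refine absurd ?_ (G.key_fact_tip j x)
    simp only [get, G.key_fact] at h
    exact (key_congr h).le
  · by_contra hne
    exact G.key_tip_tip y x (fun h => hne (by rw [h])) (key_congr h).le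

/-! ### Every repair of the pigeonhole database satisfies the query -/

/-- The facts of the copies in a repair of the pigeonhole database. -/
theorem exists_mem_repair [Fintype ι] (hemb : Function.Injective emb) {k : ℕ} {r : σ.Database E}
    (hr : IsRepair (G.db emb k) r) {h i : ℕ} {a : ι × Bool ⊕ ZMod 3} (hh : h < 2 * k + 1)
    (hi : i < 2 * k + 2) (hv : Valid k i a) :
    ∃ h' i' a', h' < 2 * k + 1 ∧ i' < 2 * k + 2 ∧ G.copy emb h' i' a' ∈ r ∧
      keyTuple (G.get a') = keyTuple (G.get a) ∧
        ∀ x ∈ key (G.get a'), G.label h' i' x = G.label h i x := by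
  obtain ⟨g, hg, hk⟩ := hr.exists_keyEq (mem_db.2 ⟨h, i, a, hh, hi, hv, rfl⟩)
  obtain ⟨h', i', a', hh', hi', -, rfl⟩ := mem_db.1 (hr.1.1 hg)
  obtain ⟨h1, h2⟩ := (keyEq_copy hemb).1 hk
  exact ⟨h', i', a', hh', hi', hg, h1, h2⟩

theorem db_mem_certain [Fintype ι] (hemb : Function.Injective emb) (k : ℕ) :
    G.db emb k ∈ q.certain E := by
  intro r hr
  by_contra hsat
  have hint : ∀ h < 2 * k + 1, ∀ i < 2 * k + 2, ∀ j : ι, ∃ b, G.copy emb h i (.inl (j, b)) ∈ r := by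
    intro h hh i hi j
    obtain ⟨h', i', a', -, -, hm, hk, hl⟩ :=
      exists_mem_repair hemb hr hh hi (valid_inl k i (j, true))
    obtain ⟨b, rfl⟩ := get_inl_keyEq hk
    have hsep := label_sep hl
    have hn : ∀ x, ¬ key (G.get (.inl (j, b))) ⊆ key (G.tip x) := fun x hx =>
      G.key_fact_tip j x ((key_congr (G.key_fact j b)).symm.le.trans hx)
    have h1 := hsep.1 (hn 0)
    have h2 := hsep.2.1 (hn 2)
    have h3 := hsep.2.2 (hn 1)
    obtain rfl : i' = i := by omega
    subst h1
    exact ⟨b, hm⟩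
  have hone : ∀ h < 2 * k + 1, ∀ i < 2 * k + 2, ∀ x y, x ≠ y →
      G.copy emb h i (.inr x) ∈ r → G.copy emb h i (.inr y) ∉ r := by
    intro h hh i hi x y hxy hx hy
    choose s hs using hint h hh i hi
    obtain ⟨f, g, hf, hg, μ, hfμ, hgμ⟩ := G.blocked s x y hxy
    have hmem : ∀ f, (f = G.tip x ∨ f = G.tip y ∨ ∃ i, f = G.fact i (s i)) →
        (fun p => emb (f p, G.label h i (f p))) ∈ r := by
      rintro f (rfl | rfl | ⟨j, rfl⟩)
      · exact hx
      · exact hy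
      · exact hs j
    -- Within one copy the label depends on the element only, so solutions lift.
    refine hsat ⟨_, hmem f hf, _, hmem g hg, fun v => emb (μ v, G.label h i (μ v)), ?_, ?_⟩
    · rw [← hfμ]; rfl
    · rw [← hgμ]; rfl
  have hroot : ∀ i : Fin (2 * k + 2), ∃ h : Fin (2 * k + 1), G.copy emb h i (.inr 0) ∈ r := by
    intro i
    obtain ⟨h', i', a', hh', -, hm, hk, hl⟩ :=
      exists_mem_repair hemb hr (h := 0) (by omega) i.2 (valid_zero k i)
    obtain rfl := get_inr_keyEq hk
    have hsep := label_sep hl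
    have h2 := hsep.2.1 (G.key_tip_tip 0 2 (by decide))
    have h3 := hsep.2.2 (G.key_tip_tip 0 1 (by decide))
    obtain rfl : i' = i := by omega
    exact ⟨⟨h', hh'⟩, hm⟩
  have hlink : ∀ h < 2 * k + 1, ∀ l < 2 * k + 2, 0 < l →
      G.copy emb h (l - 1) (.inr (low l)) ∈ r ∨ G.copy emb h l (.inr (low l)) ∈ r := by
    intro h hh l hl h0
    obtain ⟨h', i', a', -, -, hm, hk, hlab⟩ :=
      exists_mem_repair hemb hr hh hl (valid_low h0 hl).1
    obtain rfl := get_inr_keyEq hk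
    have hsep := label_sep hlab
    have h1 := hsep.1 (G.key_tip_tip _ 0 (low_ne_zero l))
    subst h1
    have hi' : i' = l - 1 ∨ i' = l := by
      by_cases h : l % 2 = 1
      · have := hsep.2.1 (G.key_tip_tip (low l) 2 (by simp only [low, h, if_true]; decide))
        omega
      · have := hsep.2.2 (G.key_tip_tip (low l) 1 (by simp only [low, h, if_false]; decide))
        omega
    rcases hi' with rfl | rfl
    · exact .inl hm
    · exact .inr hm
  choose ρ hρ using hroot
  obtain ⟨i, i', hne, heq⟩ := Fintype.exists_ne_map_eq_of_card_lt ρ (by simp)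
  wlog hlt : i < i' generalizing i i'
  · exact this i' i hne.symm heq.symm (lt_of_le_of_ne (not_lt.1 hlt) hne.symm)
  -- Two pigeons `i < i'` share a hole. Copy `i` is taken by its pigeon, so the link above it falls
  -- to copy `i + 1`, and so on up to copy `i'`, which then has two tips.
  have hup : ∀ t : ℕ, i + 1 + t ≤ i' →
      G.copy emb (ρ i) (i + 1 + t) (.inr (low (i + 1 + t))) ∈ r := by
    intro t
    induction t with
    | zero =>
      intro ht
      rcases hlink (ρ i) (ρ i).2 (i + 1) (by omega) (by omega) with h | h
      · exact absurd (hρ i) (hone _ (ρ i).2 _ (by omega) _ _ (low_ne_zero _) h)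
      · exact h
    | succ t ih =>
      intro ht
      rcases hlink (ρ i) (ρ i).2 (i + 1 + t + 1) (by omega) (by omega) with h | h
      · exact absurd (ih (by omega)) (hone _ (ρ i).2 _ (by omega) _ _ (low_succ_ne _) h)
      · exact h
  have hlt' : (i : ℕ) < i' := hlt
  have h1 := hup (i' - (i + 1)) (by omega)
  rw [show (i : ℕ) + 1 + (i' - (i + 1)) = i' by omega] at h1
  have h2 := hρ i'
  rw [← heq] at h2
  exact hone _ (ρ i).2 _ i'.2 _ _ (low_ne_zero _) h1 h2

/-! ### The greedy algorithm rejects the pigeonhole database -/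

/-- The tip that is chosen in the copy number `i` if the pigeon in the hole is `r`. -/
def state (r i : ℕ) : ZMod 3 := if i = r then 0 else if i < r then low (i + 1) else low i

variable (G emb) in
/-- The facts chosen according to the distribution `ρ` of pigeons to the holes. -/
def Sel (k : ℕ) (ρ : ℕ → ℕ) (f : σ.Term E) : Prop :=
  ∃ h i a, h < 2 * k + 1 ∧ i < 2 * k + 2 ∧ Valid k i a ∧ f = G.copy emb h i a ∧
    (a = .inr (state (ρ h) i) ∨ ∃ j, a = .inl (j, G.sel (state (ρ h) i) j))

/-- The two keys together lie in no tip key, which puts both facts into one copy, unless both are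
the same tip, possibly of different copies. `free` excludes either case. -/
theorem Sel.not_sol (hemb : Function.Injective emb) (hdet : q.TwoWayDetermined) {k : ℕ} {ρ : ℕ → ℕ}
    {f g : σ.Term E} (hf : G.Sel emb k ρ f) (hg : G.Sel emb k ρ g) : ¬ q.Sol f g := by
  intro hs
  obtain ⟨h, i, a, -, -, -, rfl, ha⟩ := hf
  obtain ⟨h', i', a', -, -, -, rfl, ha'⟩ := hg
  obtain ⟨h1, h2⟩ := sol_copy hemb hdet hs
  have hsep := label_sep h2
  have key : (∀ x, ¬ key (G.get a) ∪ key (G.get a') ⊆ key (G.tip x)) → False := by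
    intro hn
    have e1 := hsep.1 (hn 0)
    have e2 := hsep.2.1 (hn 2)
    have e3 := hsep.2.2 (hn 1)
    obtain rfl : i' = i := by omega
    subst e1
    refine G.free (state (ρ h) i') _ _ ?_ ?_ h1
    · rcases ha with rfl | ⟨j, rfl⟩
      · exact .inl rfl
      · exact .inr ⟨j, rfl⟩
    · rcases ha' with rfl | ⟨j, rfl⟩
      · exact .inl rfl
      · exact .inr ⟨j, rfl⟩
  rcases a with ⟨j, b⟩ | x
  · exact key fun x hx => G.key_fact_tip j x
      (((key_congr (G.key_fact j b)).symm.le.trans Set.subset_union_left).trans hx)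
  rcases a' with ⟨j, b⟩ | y
  · exact key fun x hx => G.key_fact_tip j x
      (((key_congr (G.key_fact j b)).symm.le.trans Set.subset_union_right).trans hx)
  by_cases hxy : x = y
  · subst hxy
    exact G.free x _ _ (.inl rfl) (.inl rfl) h1
  · refine key fun z hz => ?_
    by_cases hxz : x = z
    · exact G.key_tip_tip y z (fun h => hxy (hxz.trans h.symm))
        (Set.subset_union_right.trans hz)
    · exact G.key_tip_tip x z hxz (Set.subset_union_left.trans hz)

variable (G emb) in
/-- The sets of facts that some distribution of pigeons to holes chooses. -/
def Good (k : ℕ) (S : σ.Database E) : Prop :=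
  ∃ ρ : ℕ → ℕ, (∀ h < 2 * k + 1, ∀ h' < 2 * k + 1, ρ h = ρ h' → ρ h < 2 * k + 2 → h = h') ∧
    ∀ f ∈ S, G.Sel emb k ρ f

/-- The distribution already answers internal blocks and links. It changes only for a pigeon that
sits in no hole touched by `S`, and `S` leaves some hole untouched. -/
theorem Good.exists_mem [Fintype ι] (hemb : Function.Injective emb) {k : ℕ} {S : σ.Database E}
    (hS : G.Good emb k S) (hcard : S.card ≤ k) {f : σ.Term E} (hf : f ∈ G.db emb k) :
    ∃ u ∈ G.db emb k, KeyEq u f ∧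
      ∀ S' : σ.Database E, (S' : Set (σ.Term E)) ⊆ (S : Set (σ.Term E)) ∪ {u} → G.Good emb k S' := by
  classical
  obtain ⟨ρ, hρ, hsel⟩ := hS
  obtain ⟨h, i, a, hh, hi, hv, rfl⟩ := mem_db.1 hf
  have main : ∀ (ρ' : ℕ → ℕ), (∀ h < 2 * k + 1, ∀ h' < 2 * k + 1,
      ρ' h = ρ' h' → ρ' h < 2 * k + 2 → h = h') → (∀ f ∈ S, G.Sel emb k ρ' f) →
      ∀ h' i' a', h' < 2 * k + 1 → i' < 2 * k + 2 → Valid k i' a' →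
      keyTuple (G.copy emb h' i' a') = keyTuple (G.copy emb h i a) →
      (a' = .inr (state (ρ' h') i') ∨ ∃ j, a' = .inl (j, G.sel (state (ρ' h') i') j)) →
      ∃ u ∈ G.db emb k, KeyEq u (G.copy emb h i a) ∧
      ∀ S' : σ.Database E, (S' : Set (σ.Term E)) ⊆ (S : Set (σ.Term E)) ∪ {u} →
        G.Good emb k S' := by
    intro ρ' h1 h2 h' i' a' hh' hi' hv' hk ha'
    refine ⟨_, mem_db.2 ⟨h', i', a', hh', hi', hv', rfl⟩, hk, fun S' hS' => ⟨ρ', h1, ?_⟩⟩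
    intro f hf
    rcases hS' hf with hf | rfl
    · exact h2 f hf
    · exact ⟨h', i', a', hh', hi', hv', rfl, ha'⟩
  rcases a with ⟨j, b⟩ | x
  · refine main ρ hρ hsel h i (.inl (j, G.sel (state (ρ h) i) j)) hh hi (valid_inl _ _ _) ?_
      (.inr ⟨j, rfl⟩)
    rw [keyEq_copy hemb]
    exact ⟨by simp only [get, G.key_fact], fun _ _ => rfl⟩
  by_cases hx : x = 0
  · subst hx
    choose! H I A hH hI hV hA hA' using hsel
    by_cases hex : ∃ h' ∈ S.image H, h' < 2 * k + 1 ∧ ρ h' = i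
    · obtain ⟨h', -, hh', hρi⟩ := hex
      refine main ρ hρ ?_ h' i (.inr 0) hh' hi (valid_zero _ _) ?_ ?_
      · intro f hf
        exact ⟨H f, I f, A f, hH f hf, hI f hf, hV f hf, hA f hf, hA' f hf⟩
      · rw [keyEq_copy hemb]
        refine ⟨rfl, fun x hx => ?_⟩
        simp only [get] at hx
        simp [label, hx]
      · left; simp [state, hρi]
    · push Not at hex
      obtain ⟨h', hh', hnot⟩ : ∃ h' ∈ Finset.range (2 * k + 1), h' ∉ S.image H := by
        by_contra hc
        push Not at hc
        have h1 := Finset.card_le_card (show Finset.range (2 * k + 1) ⊆ S.image H from hc)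
        have h2 := Finset.card_image_le (s := S) (f := H)
        simp at h1
        omega
      rw [Finset.mem_range] at hh'
      -- Pigeon `i` moves to the untouched hole `h'`. The other untouched holes are emptied, since
      -- `i` may have sat there; `2 * k + 2` is not a pigeon and stands for an empty hole.
      refine main (fun g => if g ∈ S.image H then ρ g else if g = h' then i else 2 * k + 2)
        ?_ ?_ h' i (.inr 0) hh' hi (valid_zero _ _) ?_ ?_
      · intro g hg g' hg' he hlt
        by_cases m : g ∈ S.image H <;> by_cases m' : g' ∈ S.image H
        · simp only [m, m', if_true] at he hlt
          exact hρ g hg g' hg' he hlt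
        · simp only [m, m', if_true, if_false] at he hlt
          split_ifs at he
          · exact absurd he (hex g m hg)
          · omega
        · simp only [m, m', if_true, if_false] at he hlt
          split_ifs at he hlt
          · exact absurd he.symm (hex g' m' hg')
          · omega
        · simp only [m, m', if_false] at he hlt
          split_ifs at he hlt <;> omega
      · intro f hf
        have : H f ∈ S.image H := Finset.mem_image_of_mem _ hf
        refine ⟨H f, I f, A f, hH f hf, hI f hf, hV f hf, hA f hf, ?_⟩
        simp only [this, if_true]
        exact hA' f hf
      · rw [keyEq_copy hemb]
        refine ⟨rfl, fun x hx => ?_⟩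
        simp only [get] at hx
        simp [label, hx]
      · left; simp [state, hnot]
  · obtain ⟨l, h0, hl, hlx, hil⟩ : ∃ l, 0 < l ∧ l < 2 * k + 2 ∧ low l = x ∧ (i = l ∨ i = l - 1) := by
      have hx12 : ∀ x : ZMod 3, x ≠ 0 → x = 1 ∨ x = 2 := by decide
      rcases hx12 x hx with rfl | rfl
      · by_cases hpar : i % 2 = 1
        · exact ⟨i, by omega, hi, by simp [low, hpar], .inl rfl⟩
        · exact ⟨i + 1, by omega, by omega, if_pos (by omega), .inr (by omega)⟩
      · have := hv rfl
        by_cases hpar : i % 2 = 1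
        · exact ⟨i + 1, by omega, by omega, if_neg (by omega), .inr (by omega)⟩
        · exact ⟨i, by omega, hi, if_neg (by omega), .inl rfl⟩
    subst hlx
    have hk : keyTuple (G.copy emb h l (.inr (low l))) =
        keyTuple (G.copy emb h i (.inr (low l))) := by
      rcases hil with rfl | rfl
      · rfl
      · exact (keyEq_link hemb h h0).symm
    -- As in `state`, copies above the pigeon use the link below them, and copies under it the link
    -- above them.
    by_cases hlt : ρ h < l
    · refine main ρ hρ hsel h l (.inr (low l)) hh hl (valid_low h0 hl).1 hk (.inl ?_)
      have : ¬ l = ρ h := by omega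
      have h2 : ¬ l < ρ h := by omega
      simp [state, this, h2]
    · refine main ρ hρ hsel h (l - 1) (.inr (low l)) hh (by omega) (valid_low h0 hl).2
        ((keyEq_link hemb h h0).trans hk) (.inl ?_)
      have : ¬ l - 1 = ρ h := by omega
      have h2 : l - 1 < ρ h := by omega
      have h3 : l - 1 + 1 = l := by omega
      simp [state, this, h2, h3]

/-- Being not `Good` is an invariant of the fixpoint, whereas the empty set is `Good` by leaving all
holes empty. -/
theorem db_notMem_cert [Fintype ι] (hemb : Function.Injective emb) (hdet : q.TwoWayDetermined)
    (k : ℕ) : G.db emb k ∉ q.Cert k E := by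
  have key : ∀ S, q.Delta k (G.db emb k) S → ¬ G.Good emb k S := by
    intro S hS
    induction hS with
    | init S hS hq =>
      rintro ⟨ρ, -, hsel⟩
      obtain ⟨f, hf, g, hg, hs⟩ := hq
      exact (hsel f hf).not_sol hemb hdet (hsel g hg) hs
    | step S hS B hB S' hsub hmem ih =>
      intro hgood
      obtain ⟨f, hf, rfl⟩ := hB
      obtain ⟨u, hu, hk, hS'⟩ := hgood.exists_mem hemb hS.2.1 hf
      exact ih u ⟨hu, hk⟩ (hS' _ (hsub u ⟨hu, hk⟩))
  intro hc
  refine key ∅ hc ⟨fun _ => 2 * k + 2, ?_, ?_⟩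
  · intro h _ h' _ _ hlt
    exact absurd hlt (lt_irrefl _)
  · simp

theorem certain_ne_cert [Finite ι] (G : Gadget q ι W) (hdet : q.TwoWayDetermined)
    (hW : Nonempty (W × ℕ × ℕ × ℕ ↪ E)) (k : ℕ) : q.certain E ≠ q.Cert k E := by
  obtain ⟨emb, hemb⟩ := hW
  have := Fintype.ofFinite ι
  intro h
  exact db_notMem_cert (G := G) hemb hdet k (h ▸ db_mem_certain hemb k)

end Gadget

/-! ### Directed solutions and levels modulo 3 -/

namespace TwoAtomQuery

variable {σ : Schema} {V E F : Type*} (q : TwoAtomQuery σ V)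

/-- The atom `A` for `true` and the atom `B` for `false`. -/
def side (d : Bool) : σ.Term V := if d then q.A else q.B

/-- `q(xy)` for `true` and `q(yx)` for `false`. -/
def DirSol (d : Bool) (x y : σ.Term E) : Prop :=
  ∃ μ : V → E, μ ∘ q.side d = x ∧ μ ∘ q.side (!d) = y

variable {q}

theorem DirSol.symm {d : Bool} {x y : σ.Term E} (h : q.DirSol d x y) : q.DirSol (!d) y x := by
  obtain ⟨μ, h1, h2⟩ := h
  exact ⟨μ, h2, by rwa [Bool.not_not]⟩

theorem DirSol.map {d : Bool} {x y : σ.Term E} (h : q.DirSol d x y) (f : E → F) :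
    q.DirSol d (f ∘ x) (f ∘ y) := by
  obtain ⟨μ, rfl, rfl⟩ := h
  exact ⟨f ∘ μ, rfl, rfl⟩

theorem TwoWayDetermined.key_side (hdet : q.TwoWayDetermined) (d : Bool) (p : Fin σ.keyLen) :
    ∃ p', q.side (!d) p' = keyTuple (q.side d) p := by
  cases d
  · exact hdet.2.2.2 ⟨p, rfl⟩
  · exact hdet.2.2.1 ⟨p, rfl⟩

theorem TwoWayDetermined.exists_notMem (hdet : q.TwoWayDetermined) (d : Bool) :
    ∃ p, keyTuple (q.side d) p ∉ key (q.side (!d)) := by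
  cases d
  · obtain ⟨_, ⟨p, rfl⟩, h⟩ := Set.not_subset.1 hdet.2.1
    exact ⟨p, h⟩
  · obtain ⟨_, ⟨p, rfl⟩, h⟩ := Set.not_subset.1 hdet.1
    exact ⟨p, h⟩

/-- The key of the partner's atom consists of variables that `x` already fixes. -/
theorem DirSol.key_unique (hdet : q.TwoWayDetermined) {d : Bool} {x y y' : σ.Term E}
    (h : q.DirSol d x y) (h' : q.DirSol d x y') : keyTuple y = keyTuple y' := by
  obtain ⟨μ, h1, rfl⟩ := h
  obtain ⟨ν, h2, rfl⟩ := h'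
  funext p
  obtain ⟨p', hp'⟩ := hdet.key_side (!d) p
  rw [Bool.not_not] at hp'
  have h1' := congrFun h1 p'
  rw [← congrFun h2 p'] at h1'
  simp only [Function.comp_apply, hp'] at h1'
  exact h1'

end TwoAtomQuery

open TwoAtomQuery

/-- The level that is reached from the level `a` in the direction `d`. -/
def step (d : Bool) (a : ZMod 3) : ZMod 3 := if d then a + 1 else a - 1

/-- The level of the assignment between the levels `a` and `step d a`. -/
def idx (d : Bool) (a : ZMod 3) : ZMod 3 := if d then a else a - 1

theorem step_inj_left {d d' : Bool} {a : ZMod 3} (h : step d a = step d' a) : d = d' := by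
  revert d d' a; decide

theorem step_ne (d : Bool) (a : ZMod 3) : step d a ≠ a := by
  revert d a; decide

theorem step_add (d : Bool) (a b : ZMod 3) : step d (a + b) = step d a + b := by
  revert d a b; decide

theorem step_eq_symm {d : Bool} {a b : ZMod 3} (h : b = step d a) : a = step (!d) b := by
  revert d a b; decide

/-! ### The symmetric triangle with labels -/

/-- A triangle `q(t₀ t₁)`, `q(t₁ t₂)`, `q(t₂ t₀)` of facts in three distinct blocks. -/
structure Triangle {σ : Schema} {V : Type*} (q : TwoAtomQuery σ V) (E : Type*) where
  tri : ZMod 3 → σ.Term E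
  sol : ∀ a, q.Sol (tri a) (tri (a + 1))
  key_inj : ∀ a b, keyTuple (tri a) = keyTuple (tri b) → a = b

namespace Triangle

variable {σ : Schema} {V E L : Type*} {q : TwoAtomQuery σ V} (T : Triangle q E)

/-- The symmetric triangle over triples of elements. -/
def typ (a : ZMod 3) : σ.Term (ZMod 3 → E) := fun p r => T.tri (a + r) p

/-- The assignments of the triangle. -/
noncomputable def val (a : ZMod 3) : V → E := (T.sol a).choose

/-- The assignments of the symmetric triangle. -/
noncomputable def mval (a : ZMod 3) (v : V) : ZMod 3 → E := fun r => T.val (a + r) v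

theorem val_A (a : ZMod 3) (p : Fin σ.arity) : T.val a (q.A p) = T.tri a p :=
  congrFun (T.sol a).choose_spec.1 p

theorem val_B (a : ZMod 3) (p : Fin σ.arity) : T.val a (q.B p) = T.tri (a + 1) p :=
  congrFun (T.sol a).choose_spec.2 p

theorem val_side (d : Bool) (a : ZMod 3) (p : Fin σ.arity) :
    T.val (idx d a) (q.side d p) = T.tri a p ∧
      T.val (idx d a) (q.side (!d) p) = T.tri (step d a) p := by
  cases d
  · simp [idx, side, val_A, val_B, step]
  · simp [idx, side, val_A, val_B, step]

theorem mval_side (d : Bool) (a : ZMod 3) (p : Fin σ.arity) :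
    T.mval (idx d a) (q.side d p) = T.typ a p ∧
      T.mval (idx d a) (q.side (!d) p) = T.typ (step d a) p := by
  constructor <;> funext r
  · have : idx d a + r = idx d (a + r) := by revert d a r; decide
    simp only [mval, typ, this, (T.val_side d (a + r) p).1]
  · have : idx d a + r = idx d (a + r) := by revert d a r; decide
    simp only [mval, typ, this, (T.val_side d (a + r) p).2, step_add]

theorem dirSol_tri (d : Bool) (a : ZMod 3) : q.DirSol d (T.tri a) (T.tri (step d a)) :=
  ⟨T.val (idx d a), funext fun p => (T.val_side d a p).1, funext fun p => (T.val_side d a p).2⟩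

variable [Zero L]

open Classical in
/-- The fact of level `a` with the labels `φ`, where nonzero labels are tagged with `X`. -/
noncomputable def elt (a : ZMod 3) (φ : σ.Term L) (X : ZMod 3) :
    σ.Term ((ZMod 3 → E) × L × ZMod 3) :=
  fun p => (T.typ a p, φ p, if φ p = 0 then 0 else X)

theorem keyTuple_elt {a b : ZMod 3} {φ ψ : σ.Term L} (X : ZMod 3) (hab : a = b)
    (h : keyTuple φ = keyTuple ψ) : keyTuple (T.elt a φ X) = keyTuple (T.elt b ψ X) := by
  subst hab
  funext p
  have := congrFun h p
  simp only [keyTuple] at this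
  simp only [keyTuple, elt]
  rw [this]

theorem key_of_keyTuple_elt {a b : ZMod 3} {φ ψ : σ.Term L} {X Y : ZMod 3}
    (h : keyTuple (T.elt a φ X) = keyTuple (T.elt b ψ Y)) :
    a = b ∧ keyTuple φ = keyTuple ψ ∧ (X ≠ Y → ∀ p, keyTuple φ p = 0) := by
  have hp := fun p => congrFun h p
  simp only [keyTuple, elt, Prod.mk.injEq] at hp
  refine ⟨T.key_inj _ _ (funext fun p => ?_), funext fun p => (hp p).2.1, fun hXY p => ?_⟩
  · have := congrFun (hp p).1 0
    simpa [typ, keyTuple] using this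
  · have h1 := (hp p).2.1
    have h2 := (hp p).2.2
    rw [← h1] at h2
    by_contra hne
    simp only [keyTuple] at hne
    rw [if_neg hne, if_neg hne] at h2
    exact hXY h2

theorem dirSol_elt {d : Bool} {φ ψ : σ.Term L} (h : q.DirSol d φ ψ) (a X : ZMod 3) :
    q.DirSol d (T.elt a φ X) (T.elt (step d a) ψ X) := by
  classical
  obtain ⟨μ, rfl, rfl⟩ := h
  refine ⟨fun v => (T.mval (idx d a) v, μ v, if μ v = 0 then 0 else X), ?_, ?_⟩
  · funext p
    simp only [Function.comp_apply, elt, (T.mval_side d a p).1]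
  · funext p
    simp only [Function.comp_apply, elt, (T.mval_side d a p).2]

/-- Projecting to the triangle, a fact determines its partner's key and hence the level. Key
elements occur in both facts, so a nonzero label there would make the tags equal. -/
theorem of_dirSol_elt (hdet : q.TwoWayDetermined) {d : Bool} {a b : ZMod 3} {φ ψ : σ.Term L}
    {X Y : ZMod 3} (h : q.DirSol d (T.elt a φ X) (T.elt b ψ Y)) :
    b = step d a ∧ q.DirSol d φ ψ ∧
      (X ≠ Y → ∀ p, keyTuple φ p = 0 ∧ keyTuple ψ p = 0) := by
  refine ⟨?_, h.map fun x => x.2.1, fun hXY p => ?_⟩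
  · have h1 : q.DirSol d (T.tri a) (T.tri b) := by
      have := h.map fun x => x.1 0
      convert this using 1 <;> funext p <;> simp [elt, typ]
    exact T.key_inj _ _ (h1.key_unique hdet (T.dirSol_tri d a))
  · have key : ∀ {d : Bool} {a b : ZMod 3} {φ ψ : σ.Term L} {X Y : ZMod 3},
        q.DirSol d (T.elt a φ X) (T.elt b ψ Y) → X ≠ Y → keyTuple φ p = 0 := by
      intro d a b φ ψ X Y h hXY
      obtain ⟨μ, h1, h2⟩ := h
      obtain ⟨p', hp'⟩ := hdet.key_side d p
      have e1 : _ = T.elt a φ X _ := congrFun h1 (Fin.castLE σ.keyLen_le p)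
      have e2 : _ = T.elt b ψ Y _ := congrFun h2 p'
      simp only [Function.comp_apply, hp'] at e1 e2
      have e3 := e1.symm.trans e2
      simp only [elt, Prod.mk.injEq] at e3
      by_contra hne
      simp only [keyTuple] at hne
      have e4 := e3.2.2
      rw [← e3.2.1, if_neg hne, if_neg hne] at e4
      exact hXY e4
    exact ⟨key h hXY, key h.symm hXY.symm⟩

end Triangle

/-! ### From arms to gadgets -/

/-- An alternating path of key-equal facts and solutions
`t 0 ∼ u 0 – t 1 ∼ u 1 – ⋯ – t J` that starts in a block of the symmetric triangle and in which
no other two of the facts `t j`, and no two of the facts `u j`, form a solution. -/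
structure Arm {σ : Schema} {V E : Type*} {q : TwoAtomQuery σ V} (T : Triangle q E)
    (L : Type*) [Zero L] where
  J : ℕ
  J_pos : 0 < J
  lev : ℕ → ZMod 3
  dir : ℕ → Bool
  t : ℕ → σ.Term L
  u : ℕ → σ.Term L
  t_zero : ∀ p, t 0 p = 0
  sol : ∀ j < J, q.DirSol (dir j) (u j) (t (j + 1))
  lev_succ : ∀ j < J, lev (j + 1) = step (dir j) (lev j)
  key_eq : ∀ j < J, keyTuple (u j) = keyTuple (t j)
  nonzero : ∀ j, 0 < j → j ≤ J → ∃ p, keyTuple (t j) p ≠ 0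
  not_sol_t : ∀ i j d, i < j → j ≤ J → lev j = step d (lev i) → ¬ q.DirSol d (t i) (t j)
  not_sol_u : ∀ i j d, i < j → j < J → lev j = step d (lev i) → ¬ q.DirSol d (u i) (u j)
  not_sol_zero : ¬ q.DirSol (!dir 0) (u 0) (t 0)
  key_ne : ∀ i j, i < j → j < J → lev i = lev j → keyTuple (t i) ≠ keyTuple (t j)
  -- This keeps inner keys out of the tip keys; `r` and `r'` account for the rotations of the arms
  -- compared.
  big : ∀ j < J, ∀ r r', ∃ p, keyTuple (t j) p = 0 ∧ ∀ p', keyTuple (t J) p' = 0 →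
    keyTuple (T.typ (lev j + r)) p ≠ keyTuple (T.typ (lev J + r')) p'

namespace Arm

variable {σ : Schema} {V E L : Type*} [Zero L] {q : TwoAtomQuery σ V} {T : Triangle q E}
  (R : Arm T L)

/-- The facts `t` for `true` and `u` for `false`. -/
def tu (b : Bool) : ℕ → σ.Term L := if b then R.t else R.u

theorem key_tu (b : Bool) {j : ℕ} (hj : j < R.J) : keyTuple (R.tu b j) = keyTuple (R.t j) := by
  cases b
  · exact R.key_eq j hj
  · rfl

theorem eq_of_key (i j : ℕ) (hi : i < R.J) (hj : j < R.J) (hl : R.lev i = R.lev j)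
    (hk : keyTuple (R.t i) = keyTuple (R.t j)) : i = j := by
  rcases lt_trichotomy i j with h | h | h
  · exact absurd hk (R.key_ne i j h hj hl)
  · exact h
  · exact absurd hk.symm (R.key_ne j i h hi hl.symm)

theorem eq_zero_of_key {j : ℕ} (hj : j ≤ R.J) (h : ∀ p, keyTuple (R.t j) p = 0) : j = 0 := by
  by_contra hne
  obtain ⟨p, hp⟩ := R.nonzero j (Nat.pos_of_ne_zero hne) hj
  exact hp (h p)

theorem not_sol_same (b : Bool) {i j : ℕ} {d : Bool} (hi : i < R.J ∨ i = R.J ∧ b = true)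
    (hj : j < R.J ∨ j = R.J ∧ b = true) (hl : R.lev j = step d (R.lev i)) :
    ¬ q.DirSol d (R.tu b i) (R.tu b j) := by
  have main : ∀ {i j : ℕ} {d : Bool}, i < j → (j < R.J ∨ j = R.J ∧ b = true) →
      R.lev j = step d (R.lev i) → ¬ q.DirSol d (R.tu b i) (R.tu b j) := by
    intro i j d hij hj hl
    cases b
    · exact R.not_sol_u i j d hij (by simpa using hj) hl
    · exact R.not_sol_t i j d hij (by omega) hl
  rcases lt_trichotomy i j with h | h | h
  · exact main h hj hl
  · subst h; exact absurd hl.symm (step_ne _ _)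
  · exact fun hs => main h hi (step_eq_symm hl) hs.symm

/-- In the direction `dir 0` the partner of `u 0` has the key of `t 1`, which is nonzero. In the
other direction `u 0` with itself reduces to this by symmetry, and `t 0` is excluded by
`not_sol_zero`. -/
theorem not_sol_u_zero (hdet : q.TwoWayDetermined) (b d : Bool) :
    ¬ q.DirSol d (R.u 0) (R.tu b 0) := by
  intro hs
  by_cases hd : d = R.dir 0
  · subst hd
    have h1 := (R.sol 0 R.J_pos).key_unique hdet hs
    rw [R.key_tu b R.J_pos] at h1
    obtain ⟨p, hp⟩ := R.nonzero 1 one_pos R.J_pos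
    rw [show (1 : ℕ) = 0 + 1 from rfl, h1] at hp
    exact hp (R.t_zero _)
  · obtain rfl : d = !R.dir 0 := by cases d <;> cases h : R.dir 0 <;> simp_all
    cases b
    · have h2 := hs.symm
      rw [Bool.not_not] at h2
      have h1 := (R.sol 0 R.J_pos).key_unique hdet h2
      rw [R.key_eq 0 R.J_pos] at h1
      obtain ⟨p, hp⟩ := R.nonzero 1 one_pos R.J_pos
      rw [show (1 : ℕ) = 0 + 1 from rfl, h1] at hp
      exact hp (R.t_zero _)
    · exact R.not_sol_zero hs

/-- Three rotated copies of an arm form a gadget. -/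
noncomputable def gadget (hdet : q.TwoWayDetermined) :
    Gadget q (ZMod 3 × Fin R.J) ((ZMod 3 → E) × L × ZMod 3) where
  fact i b := T.elt (R.lev i.2 + i.1) (R.tu b i.2) i.1
  tip x := T.elt (R.lev R.J + x) (R.t R.J) x
  key_fact i b := T.keyTuple_elt _ rfl ((R.key_tu b i.2.2).trans (R.key_tu true i.2.2).symm)
  key_inj := by
    rintro ⟨X, i⟩ ⟨Y, j⟩ h
    obtain ⟨h1, h2, h3⟩ := T.key_of_keyTuple_elt h
    simp only [tu, if_true] at h1 h2 h3
    by_cases hXY : X = Y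
    · subst hXY
      have := R.eq_of_key i j i.2 j.2 (by simpa using h1) h2
      rw [Fin.ext this]
    · have hi := R.eq_zero_of_key i.2.le (h3 hXY)
      have hj := R.eq_zero_of_key j.2.le (by rw [← h2]; exact h3 hXY)
      rw [hi, hj] at h1
      exact absurd (add_left_cancel h1) hXY
  key_fact_tip := by
    rintro ⟨X, j⟩ x hsub
    obtain ⟨p, hp, hne⟩ := R.big j j.2 X x
    obtain ⟨p', hp'⟩ := hsub ⟨p, rfl⟩
    simp only [keyTuple, Triangle.elt, Prod.mk.injEq, tu, if_true] at hp' hp hne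
    exact hne p' (hp'.2.1.trans hp) hp'.1.symm
  key_tip_tip := by
    intro x y hxy hsub
    obtain ⟨p, hp⟩ := R.nonzero R.J R.J_pos le_rfl
    obtain ⟨p', hp'⟩ := hsub ⟨p, rfl⟩
    simp only [keyTuple, Triangle.elt, Prod.mk.injEq] at hp' hp
    have h2 := hp'.2.2
    rw [hp'.2.1, if_neg hp, if_neg hp] at h2
    exact hxy h2.symm
  blocked := by
    intro s x y hxy
    by_contra hno
    push Not at hno
    -- Downwards from a chosen tip: `u j` forms a solution with `t (j + 1)`, so each block has to
    -- contribute `t j`, down to the triangle.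
    have hsel : ∀ z, z = x ∨ z = y → ∀ n j, j + n = R.J →
        (T.elt (R.lev j + z) (R.t j) z = T.elt (R.lev R.J + x) (R.t R.J) x ∨
        T.elt (R.lev j + z) (R.t j) z = T.elt (R.lev R.J + y) (R.t R.J) y ∨
          ∃ i : ZMod 3 × Fin R.J, T.elt (R.lev j + z) (R.t j) z =
            T.elt (R.lev i.2 + i.1) (R.tu (s i) i.2) i.1) := by
      intro z hz n
      induction n with
      | zero =>
        rintro j rfl
        rcases hz with rfl | rfl
        · exact .inl rfl
        · exact .inr (.inl rfl)
      | succ n ih =>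
        intro j hj
        have hjJ : j < R.J := by omega
        have hnext := ih (j + 1) (by omega)
        refine .inr (.inr ⟨(z, ⟨j, hjJ⟩), ?_⟩)
        cases hs : s (z, ⟨j, hjJ⟩) with
        | true => rfl
        | false =>
          exfalso
          have h1 := T.dirSol_elt (R.sol j hjJ) (R.lev j + z) z
          rw [step_add, ← R.lev_succ j hjJ] at h1
          have hu : ∃ i : ZMod 3 × Fin R.J, T.elt (R.lev j + z) (R.u j) z =
            T.elt (R.lev i.2 + i.1) (R.tu (s i) i.2) i.1 := ⟨(z, ⟨j, hjJ⟩), by rw [hs]; rfl⟩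
          cases hd : R.dir j with
          | true =>
            rw [hd] at h1
            exact hno _ _ (.inr (.inr hu)) hnext h1
          | false =>
            rw [hd] at h1
            exact hno _ _ hnext (.inr (.inr hu)) h1.symm
    have hz : ∀ (a : ZMod 3), T.elt a (R.t 0) x = T.elt a (R.t 0) y := by
      intro a
      funext p
      simp [Triangle.elt, R.t_zero]
    have h00 : ∀ d a, q.DirSol d (T.elt a (R.t 0) x) (T.elt (step d a) (R.t 0) x) := by
      intro d a
      refine T.dirSol_elt ⟨fun _ => 0, ?_, ?_⟩ a x <;> funext p <;> simp [R.t_zero]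
    have hx := hsel x (.inl rfl) R.J 0 (by omega)
    have hy := hsel y (.inr rfl) R.J 0 (by omega)
    rw [← hz] at hy
    have hcase : ∀ l x y : ZMod 3, x ≠ y → l + y = step true (l + x) ∨ l + x = step true (l + y) := by
      decide
    rcases hcase (R.lev 0) x y hxy with h | h
    · have := h00 true (R.lev 0 + x)
      rw [← h] at this
      exact hno _ _ hx hy this
    · have := h00 true (R.lev 0 + y)
      rw [← h] at this
      exact hno _ _ hy hx this
  -- The arm with the chosen tip takes its facts `t`, the two others take `u`.
  sel x i := decide (i.1 = x)
  free := by
    have hform : ∀ x f, (f = T.elt (R.lev R.J + x) (R.t R.J) x ∨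
        ∃ i : ZMod 3 × Fin R.J, f = T.elt (R.lev i.2 + i.1) (R.tu (decide (i.1 = x)) i.2) i.1) →
        ∃ X j, (j < R.J ∨ j = R.J ∧ X = x) ∧
          f = T.elt (R.lev j + X) (R.tu (decide (X = x)) j) X := by
      rintro x f (rfl | ⟨⟨X, j⟩, rfl⟩)
      · exact ⟨x, R.J, .inr ⟨rfl, rfl⟩, by simp [tu]⟩
      · exact ⟨X, j, .inl j.2, rfl⟩
    intro x f g hf hg hs
    obtain ⟨X, i, hi, rfl⟩ := hform x f hf
    obtain ⟨Y, j, hj, rfl⟩ := hform x g hg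
    obtain ⟨h1, h2, h3⟩ := T.of_dirSol_elt hdet (d := true) hs
    by_cases hXY : X = Y
    · subst hXY
      rw [step_add] at h1
      exact R.not_sol_same _ (by simpa using hi) (by simpa using hj) (add_right_cancel h1) h2
    -- A solution between different arms needs two zero keys, so it lies in the first blocks.
    · have hzero : ∀ {X i}, (i < R.J ∨ i = R.J ∧ X = x) →
          (∀ p, keyTuple (R.tu (decide (X = x)) i) p = 0) → i = 0 := by
        rintro X i (hi | ⟨rfl, rfl⟩) hz
        · rw [R.key_tu _ hi] at hz
          exact R.eq_zero_of_key hi.le hz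
        · exact R.eq_zero_of_key le_rfl (by simpa [tu] using hz)
      obtain rfl := hzero hi fun p => (h3 hXY p).1
      obtain rfl := hzero hj fun p => (h3 hXY p).2
      by_cases hX : X = x
      · have hY : ¬ Y = x := fun h => hXY (hX.trans h.symm)
        simp only [hY, decide_false] at h2
        exact R.not_sol_u_zero hdet _ _ h2.symm
      · simp only [hX, decide_false] at h2
        exact R.not_sol_u_zero hdet _ _ h2

end Arm

/-! ### From walks to arms -/

namespace TwoAtomQuery

variable {σ : Schema} {V E : Type*} {q : TwoAtomQuery σ V}

theorem DirSol.exists_eq_key (hdet : q.TwoWayDetermined) {d : Bool} {x y : σ.Term E}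
    (h : q.DirSol d x y) (p : Fin σ.keyLen) : ∃ p', y p' = keyTuple x p := by
  obtain ⟨μ, rfl, rfl⟩ := h
  obtain ⟨p', hp'⟩ := hdet.key_side d p
  exact ⟨p', congrArg μ hp'⟩

variable (q) in
/-- The most general fact that is key-equal to a fact of a triangle and has a solution in the
direction `d` has one in the other direction, too. -/
def Bad (d : Bool) : Prop :=
  ∀ p, q.side (!d) p ∈ vars (q.side d) → q.side d p ∈ key (q.side d)

/-- Take a variable of $\mathrm{key}(B)$ outside $\mathrm{key}(A)$ and a position of it in $A$. `Bad
false` puts the variable of $B$ at this position into $\mathrm{key}(B)\subseteq\mathrm{vars}(A)$;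
then `Bad true` puts the original variable into $\mathrm{key}(A)$. -/
theorem TwoWayDetermined.exists_not_bad (hdet : q.TwoWayDetermined) : ∃ d, ¬ q.Bad d := by
  by_contra hall
  push Not at hall
  obtain ⟨p, hp⟩ := hdet.exists_notMem false
  obtain ⟨p', hp'⟩ := hdet.key_side false p
  have h1 : q.side false p' ∈ key (q.side false) := 
    hall false p' (by rw [hp']; exact ⟨_, rfl⟩)
  obtain ⟨r, hr⟩ := h1
  obtain ⟨r', hr'⟩ := hdet.key_side false r
  have h2 := hall true p' (by
    rw [Bool.not_true, ← hr, ← hr']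
    exact ⟨r', rfl⟩)
  rw [show true = !false from rfl, hp'] at h2
  exact hp h2

end TwoAtomQuery

/-- Labels with additional fresh labels. -/
def Lab (L : Type*) := L ⊕ (Bool × ℕ)

namespace Lab

variable {L : Type*}

instance [Zero L] : Zero (Lab L) := ⟨.inl 0⟩

/-- A label of the given set. -/
def base (x : L) : Lab L := .inl x

/-- A fresh label. -/
def fresh (b : Bool) (i : ℕ) : Lab L := .inr (b, i)

/-- The map that turns fresh labels into zero. -/
def strip [Zero L] : Lab L → L
  | .inl x => x
  | .inr _ => 0

theorem base_inj {x y : L} : base x = base y ↔ x = y := Sum.inl.injEq x y ▸ Iff.rfl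

theorem fresh_inj {b b' : Bool} {i i' : ℕ} :
    (fresh b i : Lab L) = fresh b' i' ↔ b = b' ∧ i = i' :=
  Sum.inr_injective.eq_iff.trans Prod.mk_inj

theorem base_ne_fresh {x : L} {b : Bool} {i : ℕ} : base x ≠ fresh b i := Sum.inl_ne_inr

theorem base_eq_zero [Zero L] {x : L} : base x = 0 ↔ x = 0 := base_inj

theorem fresh_ne_zero [Zero L] {b : Bool} {i : ℕ} : (fresh b i : Lab L) ≠ 0 := Sum.inr_ne_inl

end Lab

open Lab

/-- A path in the graph of labelled keys, from a zero key, without chords. -/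
structure Walk {σ : Schema} {V E : Type*} {q : TwoAtomQuery σ V} (T : Triangle q E)
    (L : Type*) [Zero L] where
  m : ℕ
  lev : ℕ → ZMod 3
  dir : ℕ → Bool
  lam : ℕ → V → L
  key : ℕ → Fin σ.keyLen → L
  lev_succ : ∀ i < m, lev (i + 1) = step (dir i) (lev i)
  near : ∀ i ≤ m, ∀ p, lam i (keyTuple (q.side (dir i)) p) = key i p
  far : ∀ i < m, ∀ p, lam i (keyTuple (q.side (!dir i)) p) = key (i + 1) p
  key_zero : ∀ p, key 0 p = 0
  nonzero : ∀ i, 0 < i → i ≤ m → ∃ p, key i p ≠ 0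
  chordless : ∀ i j d (μ : V → L), i + 1 < j → j ≤ m → lev j = step d (lev i) →
    (∀ p, μ (keyTuple (q.side d) p) = key i p) → ¬ ∀ p, μ (keyTuple (q.side (!d)) p) = key j p
  key_ne : ∀ i j, i < j → j ≤ m → lev i = lev j → key i ≠ key j
  not_bad : ¬ q.Bad (dir 0)
  big_near : ∀ i ≤ m, ∀ r r', ∃ p, key i p = 0 ∧
    ∀ p', keyTuple (q.side (!dir m)) p' ∈ Schema.key (q.side (dir m)) →
      lam m (keyTuple (q.side (!dir m)) p') = 0 →
      keyTuple (T.typ (lev i + r)) p ≠ keyTuple (T.typ (step (dir m) (lev m) + r')) p'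
  big_far : ∀ i < m, ∀ r r', ∃ p, keyTuple (q.side (!dir i)) p ∈ Schema.key (q.side (dir i)) ∧
    lam i (keyTuple (q.side (!dir i)) p) = 0 ∧
    ∀ p', keyTuple (q.side (!dir m)) p' ∈ Schema.key (q.side (dir m)) →
      lam m (keyTuple (q.side (!dir m)) p') = 0 →
      keyTuple (T.typ (lev (i + 1) + r)) p ≠ keyTuple (T.typ (step (dir m) (lev m) + r')) p'

namespace Walk

variable {σ : Schema} {V E L : Type*} [Zero L] {q : TwoAtomQuery σ V} {T : Triangle q E}
  (W : Walk T L)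

/-- The directions of the refined walk, in which every edge is traversed three times. -/
def dirE (j : ℕ) : Bool := if j % 3 = 1 then !W.dir (j / 3) else W.dir (j / 3)

/-- The levels of the refined walk. -/
def levE (j : ℕ) : ZMod 3 :=
  if j % 3 = 1 then step (W.dir (j / 3)) (W.lev (j / 3)) else W.lev (j / 3)

open Classical in
/-- The assignments of the refined walk. -/
noncomputable def lamE (j : ℕ) (v : V) : Lab L :=
  -- The first pass keeps only the labels of the near key. The pass back keeps the far key it finds
  -- and renews the rest, and the third pass finally reaches the far key with its labels from the
  -- walk. Neither atom's key contains the other, so both intermediate keys have a fresh label.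
  if j % 3 = 0 then
    if v ∈ Schema.key (q.side (W.dir (j / 3))) then base (W.lam (j / 3) v) else fresh true (j / 3)
  else if j % 3 = 1 then
    if v ∈ Schema.key (q.side (!W.dir (j / 3))) then
      if v ∈ Schema.key (q.side (W.dir (j / 3))) then base (W.lam (j / 3) v)
      else fresh true (j / 3)
    else fresh false (j / 3)
  else
    if v ∈ Schema.key (q.side (!W.dir (j / 3))) then base (W.lam (j / 3) v)
    else fresh false (j / 3)

/-- The facts by which the refined walk leaves its blocks. -/
noncomputable def uE (j : ℕ) : σ.Term (Lab L) := W.lamE j ∘ q.side (W.dirE j)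

/-- The facts by which the refined walk enters its blocks. -/
noncomputable def tE : ℕ → σ.Term (Lab L)
  | 0 => 0
  | j + 1 => W.lamE j ∘ q.side (!W.dirE j)

theorem dirE_zero (i : ℕ) : W.dirE (3 * i) = W.dir i := by
  have h1 : 3 * i / 3 = i := by omega
  have h2 : 3 * i % 3 = 0 := by omega
  simp [dirE, h1, h2]

theorem dirE_one (i : ℕ) : W.dirE (3 * i + 1) = !W.dir i := by
  have h1 : (3 * i + 1) / 3 = i := by omega
  have h2 : (3 * i + 1) % 3 = 1 := by omega
  simp [dirE, h1, h2]

theorem dirE_two (i : ℕ) : W.dirE (3 * i + 2) = W.dir i := by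
  have h1 : (3 * i + 2) / 3 = i := by omega
  have h2 : (3 * i + 2) % 3 = 2 := by omega
  simp [dirE, h1, h2]

theorem levE_zero (i : ℕ) : W.levE (3 * i) = W.lev i := by
  have h1 : 3 * i / 3 = i := by omega
  have h2 : 3 * i % 3 = 0 := by omega
  simp [levE, h1, h2]

theorem levE_one (i : ℕ) : W.levE (3 * i + 1) = step (W.dir i) (W.lev i) := by
  have h1 : (3 * i + 1) / 3 = i := by omega
  have h2 : (3 * i + 1) % 3 = 1 := by omega
  simp [levE, h1, h2]

theorem levE_two (i : ℕ) : W.levE (3 * i + 2) = W.lev i := by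
  have h1 : (3 * i + 2) / 3 = i := by omega
  have h2 : (3 * i + 2) % 3 = 2 := by omega
  simp [levE, h1, h2]

open Classical in
theorem lamE_zero (i : ℕ) (v : V) : W.lamE (3 * i) v =
    if v ∈ Schema.key (q.side (W.dir i)) then base (W.lam i v) else fresh true i := by
  have h1 : 3 * i / 3 = i := by omega
  have h2 : 3 * i % 3 = 0 := by omega
  simp [lamE, h1, h2]

open Classical in
theorem lamE_one (i : ℕ) (v : V) : W.lamE (3 * i + 1) v =
    if v ∈ Schema.key (q.side (!W.dir i)) then
      if v ∈ Schema.key (q.side (W.dir i)) then base (W.lam i v) else fresh true i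
    else fresh false i := by
  have h1 : (3 * i + 1) / 3 = i := by omega
  have h2 : (3 * i + 1) % 3 = 1 := by omega
  simp only [lamE, h1, h2, one_ne_zero, if_false, if_true]

open Classical in
theorem lamE_two (i : ℕ) (v : V) : W.lamE (3 * i + 2) v =
    if v ∈ Schema.key (q.side (!W.dir i)) then base (W.lam i v) else fresh false i := by
  have h1 : (3 * i + 2) / 3 = i := by omega
  have h2 : (3 * i + 2) % 3 = 2 := by omega
  simp only [lamE, h1, h2, OfNat.ofNat_ne_zero, OfNat.ofNat_ne_one, if_false]

variable {W}

/-- A fresh label lives on two consecutive passes over one edge, and so locates every fact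
containing it. -/
theorem of_lamE_eq_fresh {b : Bool} {i j : ℕ} {v : V} (h : W.lamE j v = fresh b i) :
    j / 3 = i ∧ if b then j % 3 ≤ 1 else 1 ≤ j % 3 := by
  simp only [lamE] at h
  split_ifs at h <;>
    first
    | exact absurd h base_ne_fresh
    | (rw [fresh_inj] at h
       obtain ⟨rfl, rfl⟩ := h
       refine ⟨rfl, ?_⟩
       simp only [if_true, Bool.false_eq_true, if_false]
       omega)

theorem of_uE_eq_fresh {b : Bool} {i j : ℕ} {p : Fin σ.arity} (h : W.uE j p = fresh b i) :
    j / 3 = i ∧ if b then j % 3 ≤ 1 else 1 ≤ j % 3 := of_lamE_eq_fresh h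

theorem of_tE_eq_fresh {b : Bool} {i j : ℕ} {p : Fin σ.arity} (h : W.tE j p = fresh b i) :
    0 < j ∧ (j - 1) / 3 = i ∧ if b then (j - 1) % 3 ≤ 1 else 1 ≤ (j - 1) % 3 := by
  cases j with
  | zero => exact absurd h fresh_ne_zero.symm
  | succ j => exact ⟨Nat.succ_pos j, of_lamE_eq_fresh h⟩

variable (W)

theorem sol_E (j : ℕ) : q.DirSol (W.dirE j) (W.uE j) (W.tE (j + 1)) := ⟨W.lamE j, rfl, rfl⟩

theorem keyTuple_uE_zero {i : ℕ} (hi : i ≤ W.m) (p) :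
    keyTuple (W.uE (3 * i)) p = base (W.key i p) := by
  have : keyTuple (W.uE (3 * i)) p = W.lamE (3 * i) (keyTuple (q.side (W.dir i)) p) := by
    rw [← W.dirE_zero i]; rfl
  rw [this, W.lamE_zero, if_pos ⟨p, rfl⟩, W.near i hi]

open Classical in
theorem keyTuple_tE_one (i : ℕ) (p) : keyTuple (W.tE (3 * i + 1)) p =
    if keyTuple (q.side (!W.dir i)) p ∈ Schema.key (q.side (W.dir i)) then
      base (W.lam i (keyTuple (q.side (!W.dir i)) p)) else fresh true i := by
  have : keyTuple (W.tE (3 * i + 1)) p = W.lamE (3 * i) (keyTuple (q.side (!W.dir i)) p) := by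
    rw [← W.dirE_zero i]; rfl
  rw [this, W.lamE_zero]

theorem keyTuple_uE_one (i : ℕ) : keyTuple (W.uE (3 * i + 1)) = keyTuple (W.tE (3 * i + 1)) := by
  funext p
  have : keyTuple (W.uE (3 * i + 1)) p =
      W.lamE (3 * i + 1) (keyTuple (q.side (!W.dir i)) p) := by
    rw [← W.dirE_one i]; rfl
  rw [this, W.lamE_one, if_pos ⟨p, rfl⟩, W.keyTuple_tE_one]

open Classical in
theorem keyTuple_tE_two (i : ℕ) (p) : keyTuple (W.tE (3 * i + 2)) p =
    if keyTuple (q.side (W.dir i)) p ∈ Schema.key (q.side (!W.dir i)) then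
      base (W.lam i (keyTuple (q.side (W.dir i)) p)) else fresh false i := by
  have : keyTuple (W.tE (3 * i + 2)) p =
      W.lamE (3 * i + 1) (keyTuple (q.side (W.dir i)) p) := by
    rw [← Bool.not_not (W.dir i), ← W.dirE_one i]; rfl
  rw [this, W.lamE_one, if_pos (show _ ∈ Schema.key (q.side (W.dir i)) from ⟨p, rfl⟩)]

theorem keyTuple_uE_two (i : ℕ) : keyTuple (W.uE (3 * i + 2)) = keyTuple (W.tE (3 * i + 2)) := by
  funext p
  have : keyTuple (W.uE (3 * i + 2)) p =
      W.lamE (3 * i + 2) (keyTuple (q.side (W.dir i)) p) := by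
    rw [← W.dirE_two i]; rfl
  rw [this, W.lamE_two, W.keyTuple_tE_two]

theorem keyTuple_tE_zero {i : ℕ} (hi : i ≤ W.m) (p) :
    keyTuple (W.tE (3 * i)) p = base (W.key i p) := by
  cases i with
  | zero => rw [W.key_zero]; rfl
  | succ i =>
    have : keyTuple (W.tE (3 * (i + 1))) p =
        W.lamE (3 * i + 2) (keyTuple (q.side (!W.dir i)) p) := by
      rw [← W.dirE_two i]; rfl
    rw [this, W.lamE_two, if_pos ⟨p, rfl⟩, W.far i hi]

theorem exists_key_tE_one (hdet : q.TwoWayDetermined) (i : ℕ) :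
    ∃ p, keyTuple (W.tE (3 * i + 1)) p = fresh true i := by
  obtain ⟨p, hp⟩ := hdet.exists_notMem (!W.dir i)
  rw [Bool.not_not] at hp
  exact ⟨p, by rw [W.keyTuple_tE_one, if_neg hp]⟩

theorem exists_key_tE_two (hdet : q.TwoWayDetermined) (i : ℕ) :
    ∃ p, keyTuple (W.tE (3 * i + 2)) p = fresh false i := by
  obtain ⟨p, hp⟩ := hdet.exists_notMem (W.dir i)
  exact ⟨p, by rw [W.keyTuple_tE_two, if_neg hp]⟩

theorem mod_three_cases (j : ℕ) : ∃ i, j = 3 * i ∨ j = 3 * i + 1 ∨ j = 3 * i + 2 :=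
  ⟨j / 3, by omega⟩

theorem levE_succ {j : ℕ} (hj : j < 3 * W.m + 1) :
    W.levE (j + 1) = step (W.dirE j) (W.levE j) := by
  obtain ⟨i, rfl | rfl | rfl⟩ := mod_three_cases j
  · rw [W.levE_one, W.dirE_zero, W.levE_zero]
  · rw [W.levE_two, W.dirE_one, W.levE_one]
    exact step_eq_symm rfl
  · rw [show 3 * i + 2 + 1 = 3 * (i + 1) from rfl, W.levE_zero, W.dirE_two, W.levE_two,
      W.lev_succ i (by omega)]

theorem key_eq_E {j : ℕ} (hj : j < 3 * W.m + 1) : keyTuple (W.uE j) = keyTuple (W.tE j) := by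
  obtain ⟨i, rfl | rfl | rfl⟩ := mod_three_cases j
  · funext p
    rw [W.keyTuple_uE_zero (by omega), W.keyTuple_tE_zero (by omega)]
  · exact W.keyTuple_uE_one i
  · exact W.keyTuple_uE_two i

theorem dir_of_consecutive {j : ℕ} {d : Bool} (hj : j < 3 * W.m + 1)
    (h : W.levE (j + 1) = step d (W.levE j)) : d = W.dirE j :=
  (step_inj_left ((W.levE_succ hj).symm.trans h)).symm

theorem chordless_E {x y : σ.Term (Lab L)} {i j : ℕ} {d : Bool} (hij : i + 1 < j) (hj : j ≤ W.m)
    (hl : W.levE (3 * j) = step d (W.levE (3 * i))) (hs : q.DirSol d x y)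
    (hx : ∀ p, keyTuple x p = base (W.key i p)) (hy : ∀ p, keyTuple y p = base (W.key j p)) :
    False := by
  obtain ⟨μ, rfl, rfl⟩ := hs
  rw [W.levE_zero, W.levE_zero] at hl
  refine W.chordless i j d (strip ∘ μ) hij hj hl (fun p => ?_) (fun p => ?_)
  · exact congrArg strip (hx p)
  · exact congrArg strip (hy p)

/-- Key elements of each fact occur in the other, so fresh labels leave only neighbouring indices or
two original keys of the walk. Neighbours are excluded because the partner's key is already
determined, the rest because the walk is chordless. -/
theorem not_sol_uE (hdet : q.TwoWayDetermined) {a b : ℕ} {d : Bool} (hab : a < b)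
    (hb : b < 3 * W.m + 1) (hl : W.levE b = step d (W.levE a)) :
    ¬ q.DirSol d (W.uE a) (W.uE b) := by
  intro hs
  obtain ⟨i, rfl | rfl | rfl⟩ := mod_three_cases b
  · obtain ⟨i', rfl | rfl | rfl⟩ := mod_three_cases a
    · obtain rfl | hi := (show i = i' + 1 ∨ i' + 1 < i by omega)
      · have hd : d = W.dir i' := by
          rw [W.levE_zero, W.levE_zero, W.lev_succ i' (by omega)] at hl
          exact (step_inj_left hl).symm
        subst hd
        have h1 := W.sol_E (3 * i')
        rw [W.dirE_zero] at h1
        have h2 := hs.key_unique hdet h1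
        obtain ⟨p, hp⟩ := W.exists_key_tE_one hdet i'
        rw [← h2] at hp
        have := (of_uE_eq_fresh hp).1
        omega
      · exact W.chordless_E hi (by omega) hl hs (W.keyTuple_uE_zero (by omega))
          (W.keyTuple_uE_zero (by omega))
    · obtain ⟨p, hp⟩ := W.exists_key_tE_one hdet i'
      rw [← W.keyTuple_uE_one] at hp
      obtain ⟨p', hp'⟩ := hs.exists_eq_key hdet p
      have := (of_uE_eq_fresh (hp'.trans hp)).1
      omega
    · obtain ⟨p, hp⟩ := W.exists_key_tE_two hdet i'
      rw [← W.keyTuple_uE_two] at hp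
      obtain ⟨p', hp'⟩ := hs.exists_eq_key hdet p
      have := (of_uE_eq_fresh (hp'.trans hp)).1
      omega
  · obtain ⟨p, hp⟩ := W.exists_key_tE_one hdet i
    rw [← W.keyTuple_uE_one] at hp
    obtain ⟨p', hp'⟩ := hs.symm.exists_eq_key hdet p
    have h1 := (of_uE_eq_fresh (hp'.trans hp)).1
    obtain rfl : a = 3 * i := by omega
    obtain rfl := W.dir_of_consecutive (by omega) hl
    have h2 := hs.symm
    rw [W.dirE_zero, ← W.dirE_one] at h2
    have h3 := h2.key_unique hdet (W.sol_E _)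
    obtain ⟨r, hr⟩ := W.exists_key_tE_two hdet i
    rw [show 3 * i + 2 = 3 * i + 1 + 1 from rfl, ← h3] at hr
    have h4 := of_uE_eq_fresh hr
    simp at h4
  · obtain ⟨p, hp⟩ := W.exists_key_tE_two hdet i
    rw [← W.keyTuple_uE_two] at hp
    obtain ⟨p', hp'⟩ := hs.symm.exists_eq_key hdet p
    have h1 := of_uE_eq_fresh (hp'.trans hp)
    simp only [Bool.false_eq_true, if_false] at h1
    obtain rfl : a = 3 * i + 1 := by omega
    obtain rfl := W.dir_of_consecutive (by omega) hl
    have h2 := hs.symm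
    rw [W.dirE_one, Bool.not_not, ← W.dirE_two] at h2
    have h3 := h2.key_unique hdet (W.sol_E _)
    obtain ⟨r, hr⟩ := W.exists_key_tE_one hdet i
    rw [← W.keyTuple_uE_one, h3] at hr
    have h4 := of_tE_eq_fresh hr
    simp only [if_true] at h4
    omega

theorem not_sol_tE (hdet : q.TwoWayDetermined) {a b : ℕ} {d : Bool} (hab : a < b)
    (hb : b ≤ 3 * W.m + 1) (hl : W.levE b = step d (W.levE a)) :
    ¬ q.DirSol d (W.tE a) (W.tE b) := by
  intro hs
  obtain ⟨i, rfl | rfl | rfl⟩ := mod_three_cases b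
  · obtain ⟨i', rfl | rfl | rfl⟩ := mod_three_cases a
    · obtain rfl | hi := (show i = i' + 1 ∨ i' + 1 < i by omega)
      · have hd : d = W.dir i' := by
          rw [W.levE_zero, W.levE_zero, W.lev_succ i' (by omega)] at hl
          exact (step_inj_left hl).symm
        subst hd
        have h1 := W.sol_E (3 * i' + 2)
        rw [W.dirE_two] at h1
        have h2 := hs.symm.key_unique hdet h1.symm
        obtain ⟨p, hp⟩ := W.exists_key_tE_two hdet i'
        rw [← W.keyTuple_uE_two, ← h2] at hp
        have := of_tE_eq_fresh hp
        omega
      · exact W.chordless_E hi (by omega) hl hs (W.keyTuple_tE_zero (by omega))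
          (W.keyTuple_tE_zero (by omega))
    · obtain ⟨p, hp⟩ := W.exists_key_tE_one hdet i'
      obtain ⟨p', hp'⟩ := hs.exists_eq_key hdet p
      have := of_tE_eq_fresh (hp'.trans hp)
      simp only [if_true] at this
      omega
    · obtain ⟨p, hp⟩ := W.exists_key_tE_two hdet i'
      obtain ⟨p', hp'⟩ := hs.exists_eq_key hdet p
      have := of_tE_eq_fresh (hp'.trans hp)
      obtain rfl : i = i' + 1 := by omega
      have hd : d = W.dir i' := by
        rw [W.levE_zero, W.levE_two, W.lev_succ i' (by omega)] at hl
        exact (step_inj_left hl).symm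
      subst hd
      have h1 := (W.sol_E (3 * i' + 1)).symm
      rw [W.dirE_one, Bool.not_not] at h1
      have h2 := hs.key_unique hdet h1
      obtain ⟨r, hr⟩ := W.exists_key_tE_one hdet i'
      rw [← W.keyTuple_uE_one, ← h2] at hr
      have := of_tE_eq_fresh hr
      simp only [if_true] at this
      omega
  · obtain ⟨p, hp⟩ := W.exists_key_tE_one hdet i
    obtain ⟨p', hp'⟩ := hs.symm.exists_eq_key hdet p
    have h1 := of_tE_eq_fresh (hp'.trans hp)
    omega
  · obtain ⟨p, hp⟩ := W.exists_key_tE_two hdet i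
    obtain ⟨p', hp'⟩ := hs.symm.exists_eq_key hdet p
    have h1 := of_tE_eq_fresh (hp'.trans hp)
    simp only [Bool.false_eq_true, if_false] at h1
    omega

theorem key_ne_E (hdet : q.TwoWayDetermined) {a b : ℕ} (hab : a < b) (hb : b < 3 * W.m + 1)
    (hl : W.levE a = W.levE b) : keyTuple (W.tE a) ≠ keyTuple (W.tE b) := by
  intro hk
  obtain ⟨i, rfl | rfl | rfl⟩ := mod_three_cases b
  · obtain ⟨i', rfl | rfl | rfl⟩ := mod_three_cases a
    · rw [W.levE_zero, W.levE_zero] at hl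
      refine W.key_ne i' i (by omega) (by omega) hl (funext fun p => ?_)
      have := congrFun hk p
      rw [W.keyTuple_tE_zero (by omega), W.keyTuple_tE_zero (by omega)] at this
      exact base_inj.1 this
    · obtain ⟨p, hp⟩ := W.exists_key_tE_one hdet i'
      rw [hk, W.keyTuple_tE_zero (by omega)] at hp
      exact base_ne_fresh hp
    · obtain ⟨p, hp⟩ := W.exists_key_tE_two hdet i'
      rw [hk, W.keyTuple_tE_zero (by omega)] at hp
      exact base_ne_fresh hp
  · obtain ⟨p, hp⟩ := W.exists_key_tE_one hdet i
    rw [← hk] at hp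
    have h1 := of_tE_eq_fresh hp
    omega
  · obtain ⟨p, hp⟩ := W.exists_key_tE_two hdet i
    rw [← hk] at hp
    have h1 := of_tE_eq_fresh hp
    simp only [Bool.false_eq_true, if_false] at h1
    omega

theorem nonzero_E (hdet : q.TwoWayDetermined) {j : ℕ} (h0 : 0 < j) (hj : j ≤ 3 * W.m + 1) :
    ∃ p, keyTuple (W.tE j) p ≠ 0 := by
  obtain ⟨i, rfl | rfl | rfl⟩ := mod_three_cases j
  · obtain ⟨p, hp⟩ := W.nonzero i (by omega) (by omega)
    refine ⟨p, ?_⟩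
    rw [W.keyTuple_tE_zero (by omega)]
    exact fun h => hp (base_eq_zero.1 h)
  · obtain ⟨p, hp⟩ := W.exists_key_tE_one hdet i
    exact ⟨p, hp ▸ fresh_ne_zero⟩
  · obtain ⟨p, hp⟩ := W.exists_key_tE_two hdet i
    exact ⟨p, hp ▸ fresh_ne_zero⟩

/-- Such a solution would send all variables of the atom on the side of `t 0` to zero, whereas `u 0`
is fresh at every variable outside its key; this is `Bad (dir 0)`. -/
theorem not_sol_zero_E : ¬ q.DirSol (!W.dirE 0) (W.uE 0) (W.tE 0) := by
  rintro ⟨μ, h1, h2⟩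
  rw [show (0 : ℕ) = 3 * 0 from rfl, W.dirE_zero] at h1 h2
  rw [Bool.not_not] at h2
  refine W.not_bad fun p hp => ?_
  obtain ⟨p', hp'⟩ := hp
  have e1 := congrFun h1 p
  have e2 : μ (q.side (W.dir 0) p') = 0 := congrFun h2 p'
  rw [Function.comp_apply, ← hp', e2] at e1
  have e3 : W.uE (3 * 0) p = W.lamE (3 * 0) (q.side (W.dir 0) p) := by
    rw [← W.dirE_zero 0]; rfl
  rw [e3, W.lamE_zero] at e1
  by_contra hne
  rw [if_neg hne] at e1
  exact fresh_ne_zero e1.symm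

theorem big_E {j : ℕ} (hj : j < 3 * W.m + 1) (r r' : ZMod 3) :
    ∃ p, keyTuple (W.tE j) p = 0 ∧ ∀ p', keyTuple (W.tE (3 * W.m + 1)) p' = 0 →
      keyTuple (T.typ (W.levE j + r)) p ≠ keyTuple (T.typ (W.levE (3 * W.m + 1) + r')) p' := by
  have hend : ∀ p', keyTuple (W.tE (3 * W.m + 1)) p' = 0 →
      keyTuple (q.side (!W.dir W.m)) p' ∈ Schema.key (q.side (W.dir W.m)) ∧
        W.lam W.m (keyTuple (q.side (!W.dir W.m)) p') = 0 := by
    intro p' hp'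
    rw [W.keyTuple_tE_one] at hp'
    split_ifs at hp' with h
    · exact ⟨h, base_eq_zero.1 hp'⟩
    · exact absurd hp' fresh_ne_zero
  rw [W.levE_one]
  obtain ⟨i, rfl | rfl | rfl⟩ := mod_three_cases j
  · obtain ⟨p, hp, h⟩ := W.big_near i (by omega) r r'
    refine ⟨p, ?_, fun p' hp' => ?_⟩
    · rw [W.keyTuple_tE_zero (by omega), hp]; rfl
    · rw [W.levE_zero]
      exact h p' (hend p' hp').1 (hend p' hp').2
  · obtain ⟨p, hp, hp0, h⟩ := W.big_far i (by omega) r r'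
    refine ⟨p, ?_, fun p' hp' => ?_⟩
    · rw [W.keyTuple_tE_one, if_pos hp, hp0]; rfl
    · rw [W.levE_one, ← W.lev_succ i (by omega)]
      exact h p' (hend p' hp').1 (hend p' hp').2
  · obtain ⟨p, ⟨s, hs⟩, hp0, h⟩ := W.big_far i (by omega) r r'
    refine ⟨s, ?_, fun p' hp' => ?_⟩
    · rw [W.keyTuple_tE_two, if_pos (by rw [hs]; exact ⟨p, rfl⟩), hs, hp0]; rfl
    · rw [W.levE_two]
      -- Both positions carry the same variable of the two atoms.
      have h1 : keyTuple (T.typ (W.lev i + r)) s = keyTuple (T.typ (W.lev (i + 1) + r)) p := by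
        rw [W.lev_succ i (by omega), ← step_add]
        refine (T.mval_side (W.dir i) (W.lev i + r) _).1.symm.trans
          (Eq.trans ?_ (T.mval_side (W.dir i) (W.lev i + r) _).2)
        exact congrArg _ hs
      rw [h1]
      exact h p' (hend p' hp').1 (hend p' hp').2

/-- The refinement of a walk is an arm. -/
noncomputable def arm (hdet : q.TwoWayDetermined) : Arm T (Lab L) where
  -- The last edge is traversed only once, so zero labels survive at the tip only on variables of
  -- both keys.
  J := 3 * W.m + 1
  J_pos := by omega
  lev := W.levE
  dir := W.dirE
  t := W.tE
  u := W.uE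
  t_zero _ := rfl
  sol j _ := W.sol_E j
  lev_succ _ hj := W.levE_succ hj
  key_eq _ hj := W.key_eq_E hj
  nonzero _ h0 hj := W.nonzero_E hdet h0 hj
  not_sol_t _ _ _ hab hb hl := W.not_sol_tE hdet hab hb hl
  not_sol_u _ _ _ hab hb hl := W.not_sol_uE hdet hab hb hl
  not_sol_zero := W.not_sol_zero_E
  key_ne _ _ hab hb hl := W.key_ne_E hdet hab hb hl
  big _ hj r r' := W.big_E hj r r'

end Walk

/-! ### Rotations, and elements surviving one step -/

namespace Triangle

variable {σ : Schema} {V E L : Type*} {q : TwoAtomQuery σ V} (T : Triangle q E)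

/-- The rotation of the symmetric triangle. -/
def rot (c : ZMod 3) (x : ZMod 3 → E) : ZMod 3 → E := fun r => x (c + r)

theorem rot_rot_neg (c : ZMod 3) (x : ZMod 3 → E) : rot c (rot (-c) x) = x := by
  funext r; simp [rot]

theorem rot_injective (c : ZMod 3) : Function.Injective (rot c : (ZMod 3 → E) → _) := by
  refine Function.LeftInverse.injective (g := rot (-c)) fun x => ?_
  simpa using rot_rot_neg (-c) x

theorem typ_add (a c : ZMod 3) (p : Fin σ.arity) : T.typ (a + c) p = rot c (T.typ a p) := by
  funext r; simp [typ, rot, add_assoc]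

theorem mval_add (a c : ZMod 3) (v : V) : T.mval (a + c) v = rot c (T.mval a v) := by
  funext r; simp [mval, rot, add_assoc]

theorem keyTuple_typ_add (a c : ZMod 3) (p) :
    keyTuple (T.typ (a + c)) p = rot c (keyTuple (T.typ a) p) := T.typ_add a c _

theorem key_typ_add (a c : ZMod 3) : key (T.typ (a + c)) = rot c '' key (T.typ a) := by
  ext x
  constructor
  · rintro ⟨p, rfl⟩
    exact ⟨_, ⟨p, rfl⟩, (T.keyTuple_typ_add a c p).symm⟩
  · rintro ⟨_, ⟨p, rfl⟩, rfl⟩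
    exact ⟨p, T.keyTuple_typ_add a c p⟩

/-- The elements of the key that survive one step of the assignment `s`. -/
def shared (s : ZMod 3) : Set (ZMod 3 → E) := T.mval s '' (key q.A ∩ key q.B)

theorem shared_add (s c : ZMod 3) : T.shared (s + c) = rot c '' T.shared s := by
  rw [shared, shared, Set.image_image]
  exact Set.image_congr fun v _ => T.mval_add s c v

theorem mem_key_inter_iff {d : Bool} {v : V} :
    v ∈ key q.A ∩ key q.B ↔ v ∈ key (q.side d) ∧ v ∈ key (q.side (!d)) := by
  cases d
  · exact and_comm
  · exact Iff.rfl

theorem mem_shared_iff {d : Bool} {a : ZMod 3} {x : ZMod 3 → E} : x ∈ T.shared (idx d a) ↔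
    ∃ p, keyTuple (q.side (!d)) p ∈ key (q.side d) ∧ keyTuple (T.typ (step d a)) p = x := by
  constructor
  · rintro ⟨v, hv, rfl⟩
    obtain ⟨h1, ⟨p, rfl⟩⟩ := (mem_key_inter_iff (d := d)).1 hv
    exact ⟨p, h1, (T.mval_side d a _).2.symm⟩
  · rintro ⟨p, hp, rfl⟩
    exact ⟨_, mem_key_inter_iff.2 ⟨hp, ⟨p, rfl⟩⟩, (T.mval_side d a _).2⟩

theorem shared_subset (s : ZMod 3) :
    T.shared s ⊆ key (T.typ s) ∧ T.shared s ⊆ key (T.typ (s + 1)) := by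
  constructor
  · rintro _ ⟨v, ⟨⟨p, rfl⟩, -⟩, rfl⟩
    exact ⟨p, (T.mval_side true s _).1.symm⟩
  · rintro _ ⟨v, ⟨-, ⟨p, rfl⟩⟩, rfl⟩
    exact ⟨p, (T.mval_side true s _).2.symm⟩

/-- A shared set lies in the keys at both its ends, so one key is contained in another; rotating
this inclusion around the 3-cycle makes all keys equal. -/
theorem key_typ_eq {s a : ZMod 3} (h : key (T.typ a) ⊆ T.shared s) (b b' : ZMod 3) :
    key (T.typ b) ⊆ key (T.typ b') := by
  have hrot : ∀ {a a' : ZMod 3}, key (T.typ a) ⊆ key (T.typ a') → ∀ c,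
      key (T.typ (a + c)) ⊆ key (T.typ (a' + c)) := by
    intro a a' h c
    rw [T.key_typ_add, T.key_typ_add]
    exact Set.image_mono h
  obtain ⟨e, he, h0⟩ : ∃ e, e ≠ 0 ∧ key (T.typ a) ⊆ key (T.typ (a + e)) := by
    by_cases hs : s = a
    · subst hs
      exact ⟨1, by decide, h.trans (T.shared_subset s).2⟩
    · exact ⟨s - a, sub_ne_zero.2 hs, by
        rw [add_sub_cancel]; exact h.trans (T.shared_subset s).1⟩
  have h1 : ∀ c, key (T.typ c) ⊆ key (T.typ (c + e)) := by
    intro c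
    have := hrot h0 (c - a)
    rwa [add_sub_cancel, show a + e + (c - a) = c + e by ring] at this
  have hcase : ∀ e b b' : ZMod 3, e ≠ 0 → b' = b ∨ b' = b + e ∨ b' = b + e + e := by decide
  rcases hcase e b b' he with rfl | rfl | rfl
  · exact le_rfl
  · exact h1 b
  · exact (h1 b).trans (h1 _)

theorem key_typ_subset_shared {s a : ZMod 3} (h : key (T.typ a) ⊆ T.shared s) (b s' : ZMod 3) :
    key (T.typ b) ⊆ T.shared s' := by
  have h1 : key (T.typ (a + (s' - s))) ⊆ T.shared (s + (s' - s)) := by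
    rw [T.key_typ_add, T.shared_add]
    exact Set.image_mono h
  rw [add_sub_cancel] at h1
  exact (T.key_typ_eq h _ _).trans h1

/-- A walk with one edge, if no key survives one step. -/
theorem exists_walk_of_not_subset [Zero L] (hdet : q.TwoWayDetermined)
    (h : ∀ a s, ¬ key (T.typ a) ⊆ T.shared s) : Nonempty (Walk T L) := by
  obtain ⟨d, hd⟩ := hdet.exists_not_bad
  exact ⟨{
    m := 0
    lev := fun _ => 0
    dir := fun _ => d
    lam := fun _ _ => 0
    key := fun _ _ => 0
    lev_succ := fun i hi => absurd hi (Nat.not_lt_zero i)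
    near := fun _ _ _ => rfl
    far := fun _ _ _ => rfl
    key_zero := fun _ => rfl
    nonzero := fun i h0 hi => by omega
    chordless := fun i j _ _ hij hj => by omega
    key_ne := fun i j hij hj => by omega
    not_bad := hd
    big_near := by
      intro i _ r r'
      obtain ⟨_, ⟨p, rfl⟩, hp⟩ := Set.not_subset.1 (h (0 + r) (idx d (0 + r')))
      refine ⟨p, rfl, fun p' hp' _ heq => hp ?_⟩
      rw [T.mem_shared_iff]
      exact ⟨p', hp', by rw [heq, step_add]⟩
    big_far := fun i hi => absurd hi (Nat.not_lt_zero i) }⟩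

/-! ### Shortest paths to a lost element -/

/-- A labelled key on a level. -/
abbrev State (σ : Schema) (E : Type*) := ZMod 3 × (Fin σ.keyLen → WithZero E)

variable (q) in
/-- The steps between labelled keys. -/
def Edge (d : Bool) (s s' : State σ E) : Prop :=
  s'.1 = step d s.1 ∧ ∃ μ : V → WithZero E, (∀ p, μ (keyTuple (q.side d) p) = s.2 p) ∧
    ∀ p, μ (keyTuple (q.side (!d)) p) = s'.2 p

variable (q) in
/-- The labelled keys that can be reached from a zero key in `n` steps. -/
def Reach : ℕ → State σ E → Prop
  | 0, s => ∀ p, s.2 p = 0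
  | n + 1, s => ∃ s', Reach n s' ∧ ∃ d, Edge q d s' s

/-- The labelled keys that have lost an element of the triangle. -/
def Lost (s : State σ E) : Prop :=
  ∃ x ∈ key (T.typ 0), ∀ p, s.2 p = 0 → keyTuple (T.typ s.1) p ≠ x

theorem Reach.exists_path {n : ℕ} {s : State σ E} (h : Reach q n s) :
    ∃ f : ℕ → State σ E, f n = s ∧ (∀ i ≤ n, Reach q i (f i)) ∧
      ∀ i < n, ∃ d, Edge q d (f i) (f (i + 1)) := by
  induction n generalizing s with
  | zero => exact ⟨fun _ => s, rfl, fun i hi => by rwa [Nat.le_zero.1 hi], fun i hi => by omega⟩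
  | succ n ih =>
    obtain ⟨s', hs', d, hd⟩ := h
    obtain ⟨f, hf, hr, he⟩ := ih hs'
    refine ⟨fun i => if i = n + 1 then s else f i, if_pos rfl, fun i hi => ?_, fun i hi => ?_⟩
    · by_cases hin : i = n + 1
      · subst hin
        simp only [if_true]
        exact ⟨s', hs', d, hd⟩
      · simp only [hin, if_false]
        exact hr i (by omega)
    · have h1 : ¬ i = n + 1 := by omega
      by_cases hin : i = n
      · subst hin
        simp only [h1, if_true, if_false]
        exact ⟨d, hf ▸ hd⟩
      · have h2 : ¬ i + 1 = n + 1 := by omega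
        simp only [h1, h2, if_false]
        exact he i (by omega)

/-- A shortest path from a zero key to a lost key. -/
structure ShortPath where
  m : ℕ
  lev : ℕ → ZMod 3
  dir : ℕ → Bool
  lam : ℕ → V → WithZero E
  key : ℕ → Fin σ.keyLen → WithZero E
  lev_succ : ∀ i ≤ m, lev (i + 1) = step (dir i) (lev i)
  near : ∀ i ≤ m, ∀ p, lam i (keyTuple (q.side (dir i)) p) = key i p
  far : ∀ i ≤ m, ∀ p, lam i (keyTuple (q.side (!dir i)) p) = key (i + 1) p
  reach : ∀ i ≤ m + 1, Reach q i (lev i, key i)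
  short : ∀ a, ∀ j ≤ m + 1, Reach q a (lev j, key j) → j ≤ a
  cont : ∀ i ≤ m, ∀ r, ∀ x ∈ Schema.key (T.typ 0), ∃ p, key i p = 0 ∧
    keyTuple (T.typ (lev i + r)) p = x
  cont_far : ∀ i < m, ∀ r, ∀ x ∈ Schema.key (T.typ 0), ∃ p,
    keyTuple (q.side (!dir i)) p ∈ Schema.key (q.side (dir i)) ∧
      lam i (keyTuple (q.side (!dir i)) p) = 0 ∧ keyTuple (T.typ (lev (i + 1) + r)) p = x
  lost : ∀ r, ∃ x ∈ Schema.key (T.typ 0), ∀ p, key (m + 1) p = 0 →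
    keyTuple (T.typ (lev (m + 1) + r)) p ≠ x

/-- Minimality of the length is used twice: no earlier key has lost an element, and no key on the
path can be reached sooner, as one could continue along the path from there. -/
theorem exists_shortPath [Nonempty E] (hK : ∀ b b', key (T.typ b) ⊆ key (T.typ b'))
    (hlost : ∃ n s, Reach q n s ∧ T.Lost s) : Nonempty T.ShortPath := by
  classical
  obtain ⟨s, hs, hl⟩ := Nat.find_spec hlost
  have hmin : ∀ {k}, k < Nat.find hlost → _ := Nat.find_min hlost
  set n := Nat.find hlost
  have hmin' : ∀ {k : ℕ} {s : State σ E}, Reach q k s → T.Lost s → n ≤ k := by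
    intro k s h1 h2
    by_contra hlt
    exact hmin (not_le.1 hlt) ⟨s, h1, h2⟩
  obtain ⟨f, hfn, hr, he⟩ := hs.exists_path
  have hrotK : ∀ c, ∀ x ∈ key (T.typ 0), rot c x ∈ key (T.typ 0) := by
    intro c x hx
    have : rot c x ∈ key (T.typ (0 + c)) := by
      rw [T.key_typ_add]
      exact ⟨x, hx, rfl⟩
    exact hK _ _ this
  have hnot : ∀ i < n, ¬ T.Lost (f i) := fun i hi hl => by
    have := hmin' (hr i hi.le) hl
    omega
  obtain ⟨m, hm⟩ : ∃ m, n = m + 1 := by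
    refine Nat.exists_eq_succ_of_ne_zero fun h0 => ?_
    rw [h0] at hs
    obtain ⟨x, hx, hne⟩ := hl
    obtain ⟨p, hp⟩ := hK 0 s.1 hx
    exact hne p (hs p) hp
  have he' : ∀ i, ∃ d, ∃ μ : V → WithZero E, i ≤ m → (f (i + 1)).1 = step d (f i).1 ∧
      (∀ p, μ (keyTuple (q.side d) p) = (f i).2 p) ∧
        ∀ p, μ (keyTuple (q.side (!d)) p) = (f (i + 1)).2 p := by
    intro i
    by_cases hi : i ≤ m
    · obtain ⟨d, h1, μ, h2, h3⟩ := he i (by omega)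
      exact ⟨d, μ, fun _ => ⟨h1, h2, h3⟩⟩
    · exact ⟨true, fun _ => 0, fun h => absurd h hi⟩
  choose dir lam hdl using he'
  have hshort : ∀ a, ∀ j ≤ m + 1, Reach q a (f j) → j ≤ a := by
    intro a j hj hra
    have : ∀ t, j + t ≤ n → Reach q (a + t) (f (j + t)) := by
      intro t
      induction t with
      | zero => exact fun _ => hra
      | succ t ih => exact fun ht => ⟨_, ih (by omega), he (j + t) (by omega)⟩
    have h1 := this (n - j) (by omega)
    rw [show j + (n - j) = n by omega, hfn] at h1
    have := hmin' h1 hl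
    omega
  have hcont : ∀ i ≤ m, ∀ x ∈ key (T.typ 0), ∃ p, (f i).2 p = 0 ∧
      keyTuple (T.typ (f i).1) p = x := by
    intro i hi x hx
    by_contra hno
    push Not at hno
    exact hnot i (by omega) ⟨x, hx, hno⟩
  -- Otherwise, giving a nonzero label to all variables outside the near key would lose `x` after `i
  -- + 1 < n` steps.
  have hcont_far : ∀ i < m, ∀ x ∈ key (T.typ 0), ∃ p,
      keyTuple (q.side (!dir i)) p ∈ Schema.key (q.side (dir i)) ∧
        lam i (keyTuple (q.side (!dir i)) p) = 0 ∧ keyTuple (T.typ (f (i + 1)).1) p = x := by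
    intro i hi x hx
    by_contra hno
    push Not at hno
    obtain ⟨y⟩ := (inferInstance : Nonempty E)
    have h1 : Reach q (i + 1) ((f (i + 1)).1, fun p =>
        if keyTuple (q.side (!dir i)) p ∈ Schema.key (q.side (dir i)) then
          lam i (keyTuple (q.side (!dir i)) p) else (y : WithZero E)) := by
      refine ⟨f i, hr i (by omega), dir i, (hdl i hi.le).1, fun v =>
        if v ∈ Schema.key (q.side (dir i)) then lam i v else (y : WithZero E), fun p => ?_,
        fun p => rfl⟩
      exact (if_pos ⟨p, rfl⟩).trans ((hdl i hi.le).2.1 p)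
    have h2 := hmin' h1 ⟨x, hx, fun p hp => ?_⟩
    · omega
    · by_cases hmem : keyTuple (q.side (!dir i)) p ∈ Schema.key (q.side (dir i))
      · simp only [hmem, if_true] at hp
        exact hno p hmem hp
      · simp only [hmem, if_false] at hp
        exact absurd hp WithZero.coe_ne_zero
  refine ⟨{
    m := m
    lev := fun i => (f i).1
    dir := dir
    lam := lam
    key := fun i => (f i).2
    lev_succ := fun i hi => (hdl i hi).1
    near := fun i hi => (hdl i hi).2.1
    far := fun i hi => (hdl i hi).2.2
    reach := fun i hi => hr i (by omega)
    short := hshort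
    cont := ?_
    cont_far := ?_
    lost := ?_ }⟩
  · intro i hi r x hx
    obtain ⟨p, hp, hpx⟩ := hcont i hi _ (hrotK (-r) x hx)
    exact ⟨p, hp, by rw [T.keyTuple_typ_add, hpx, rot_rot_neg]⟩
  · intro i hi r x hx
    obtain ⟨p, hp, hp0, hpx⟩ := hcont_far i hi _ (hrotK (-r) x hx)
    exact ⟨p, hp, hp0, by rw [T.keyTuple_typ_add, hpx, rot_rot_neg]⟩
  · intro r
    obtain ⟨x, hx, hne⟩ := hl
    refine ⟨rot r x, hrotK r x hx, fun p hp heq => ?_⟩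
    rw [← hm, hfn] at hp heq
    rw [T.keyTuple_typ_add] at heq
    exact hne p hp (rot_injective r heq)

namespace ShortPath

variable {T} (P : T.ShortPath)

theorem key_zero (p) : P.key 0 p = 0 := P.reach 0 (Nat.zero_le _) p

/-- A shortest path whose first step is not bad is a walk. -/
noncomputable def walk (hbad : ¬ q.Bad (P.dir 0)) : Walk T (Lab (WithZero E)) where
  -- The path has one edge more; it serves as the single pass at the end of the refined walk.
  m := P.m
  lev := P.lev
  dir := P.dir
  lam i v := base (P.lam i v)
  key i p := base (P.key i p)
  lev_succ i hi := P.lev_succ i hi.le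
  near i hi p := by rw [P.near i hi]
  far i hi p := by rw [P.far i hi.le]
  key_zero p := by rw [P.key_zero]; rfl
  nonzero i h0 hi := by
    by_contra hno
    push Not at hno
    have := P.short 0 i (by omega) fun p => base_eq_zero.1 (hno p)
    omega
  chordless i j d μ hij hj hl h1 h2 := by
    have := P.short (i + 1) j (by omega) ⟨_, P.reach i (by omega), d, hl, strip ∘ μ,
      fun p => congrArg strip (h1 p), fun p => congrArg strip (h2 p)⟩
    omega
  key_ne i j hij hj hl hk := by
    have h1 := P.reach i (by omega)
    have h2 : P.key i = P.key j := funext fun p => base_inj.1 (congrFun hk p)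
    rw [hl, h2] at h1
    have := P.short i j (by omega) h1
    omega
  not_bad := hbad
  big_near i hi r r' := by
    obtain ⟨x, hx, hne⟩ := P.lost r'
    obtain ⟨p, hp, hpx⟩ := P.cont i hi r x hx
    refine ⟨p, base_eq_zero.2 hp, fun p' _ hp' heq => ?_⟩
    rw [P.far _ le_rfl, base_eq_zero] at hp'
    rw [← P.lev_succ _ le_rfl] at heq
    exact hne p' hp' (heq.symm.trans hpx)
  big_far i hi r r' := by
    obtain ⟨x, hx, hne⟩ := P.lost r'
    obtain ⟨p, hp, hp0, hpx⟩ := P.cont_far i hi r x hx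
    refine ⟨p, hp, base_eq_zero.2 hp0, fun p' _ hp' heq => ?_⟩
    rw [P.far _ le_rfl, base_eq_zero] at hp'
    rw [← P.lev_succ _ le_rfl] at heq
    exact hne p' hp' (heq.symm.trans hpx)

/-- The levels of a shortest path with a detour at the start. -/
def levD : ℕ → ZMod 3
  | 0 => P.lev 1
  | i + 1 => P.lev i

/-- The directions of a shortest path with a detour at the start. -/
def dirD : ℕ → Bool
  | 0 => !P.dir 0
  | i + 1 => P.dir i

open Classical in
/-- The assignments of a shortest path with a detour at the start. -/
noncomputable def lamD : ℕ → V → Lab (WithZero E)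
  -- The detour starts at the level of `key 1`, steps to that of `key 0` with fresh labels, and
  -- returns. Variables of both keys have label zero here and on the path, so it arrives at `key 1`
  -- itself.
  | 0, v => if v ∈ Schema.key (q.side (!P.dir 0)) then 0 else fresh true 0
  | 1, v =>
    if v ∈ Schema.key (q.side (P.dir 0)) then
      if v ∈ Schema.key (q.side (!P.dir 0)) then 0 else fresh true 0
    else base (P.lam 0 v)
  | i + 2, v => base (P.lam (i + 1) v)

/-- The keys of a shortest path with a detour at the start. -/
noncomputable def keyD : ℕ → Fin σ.keyLen → Lab (WithZero E)
  | 0, _ => 0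
  | 1, p => P.lamD 0 (keyTuple (q.side (P.dir 0)) p)
  | i + 2, p => base (P.key (i + 1) p)

theorem lamD_zero_of_mem {v : V} (h : v ∈ Schema.key (q.side (!P.dir 0))) : P.lamD 0 v = 0 :=
  if_pos h

theorem lamD_zero_of_notMem {v : V} (h : v ∉ Schema.key (q.side (!P.dir 0))) :
    P.lamD 0 v = fresh true 0 := if_neg h

theorem lamD_one_of_mem {v : V} (h : v ∈ Schema.key (q.side (P.dir 0))) :
    P.lamD 1 v = P.lamD 0 v := if_pos h

theorem lamD_one_of_notMem {v : V} (h : v ∉ Schema.key (q.side (P.dir 0))) :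
    P.lamD 1 v = base (P.lam 0 v) := if_neg h

theorem lev_zero_eq : P.lev 0 = step (!P.dir 0) (P.lev 1) :=
  step_eq_symm (P.lev_succ 0 (Nat.zero_le _))

theorem farD {i : ℕ} (hi : i ≤ P.m) (p) :
    P.lamD (i + 1) (keyTuple (q.side (!P.dirD (i + 1))) p) = P.keyD (i + 2) p := by
  cases i with
  | zero =>
    change P.lamD 1 (keyTuple (q.side (!P.dir 0)) p) = base (P.key 1 p)
    rw [← P.far 0 hi]
    by_cases h : keyTuple (q.side (!P.dir 0)) p ∈ Schema.key (q.side (P.dir 0))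
    · rw [P.lamD_one_of_mem h, P.lamD_zero_of_mem ⟨p, rfl⟩]
      obtain ⟨p', hp'⟩ := h
      rw [← hp', P.near 0 hi, P.key_zero]
      rfl
    · rw [P.lamD_one_of_notMem h]
  | succ i =>
    simp only [dirD, lamD, keyD]
    rw [P.far (i + 1) hi]

/-- Without fresh labels the first two keys of the detour are both zero keys, so one step is saved;
hence the truncated `i - 1`. -/
theorem reachD {i : ℕ} (hi : i ≤ P.m + 1) :
    Reach q (i - 1) (P.levD i, fun p => strip (P.keyD i p)) := by
  match i with
  | 0 => exact fun p => rfl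
  | 1 =>
    intro p
    simp only [keyD, lamD]
    split_ifs <;> rfl
  | i + 2 => exact P.reach (i + 1) (by omega)

theorem exists_of_shared (hZ : ∀ s, Schema.key (T.typ 0) ⊆ T.shared s) (d : Bool) (a r : ZMod 3)
    {x} (hx : x ∈ Schema.key (T.typ 0)) :
    ∃ p, keyTuple (q.side (!d)) p ∈ Schema.key (q.side d) ∧
      keyTuple (T.typ (step d a + r)) p = x := by
  rw [← step_add]
  exact T.mem_shared_iff.1 (hZ _ hx)

/-- A shortest path with a detour at the start, which begins in the other direction. -/
noncomputable def detour (hdet : q.TwoWayDetermined) (hbad : ¬ q.Bad (!P.dir 0))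
    (hK : ∀ b b', Schema.key (T.typ b) ⊆ Schema.key (T.typ b'))
    (hZ : ∀ s, Schema.key (T.typ 0) ⊆ T.shared s) : Walk T (Lab (WithZero E)) where
  m := P.m + 1
  lev := P.levD
  dir := P.dirD
  lam := P.lamD
  key := P.keyD
  lev_succ i hi := by
    cases i with
    | zero => exact P.lev_zero_eq
    | succ i => exact P.lev_succ i (by omega)
  near i hi p := by
    match i with
    | 0 => exact P.lamD_zero_of_mem ⟨p, rfl⟩
    | 1 => exact P.lamD_one_of_mem ⟨p, rfl⟩
    | i + 2 => simp only [lamD, dirD, keyD]; rw [P.near (i + 1) (by omega)]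
  far i hi p := by
    cases i with
    | zero => simp only [dirD, Bool.not_not]; rfl
    | succ i => exact P.farD (by omega) p
  key_zero _ := rfl
  nonzero i h0 hi := by
    match i with
    | 1 =>
      obtain ⟨p, hp⟩ := hdet.exists_notMem (P.dir 0)
      refine ⟨p, ?_⟩
      rw [show P.keyD 1 p = fresh true 0 from P.lamD_zero_of_notMem hp]
      exact fresh_ne_zero
    | i + 2 =>
      by_contra hno
      push Not at hno
      have := P.short 0 (i + 1) (by omega) fun p => base_eq_zero.1 (hno p)
      omega
  chordless i j d μ hij hj hl h1 h2 := by
    obtain ⟨j, rfl⟩ : ∃ j', j = j' + 2 := ⟨j - 2, by omega⟩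
    have h3 := P.short (i - 1 + 1) (j + 1) (by omega) ⟨_, P.reachD (i := i) (by omega), d, hl,
      strip ∘ μ, fun p => congrArg strip (h1 p), fun p => congrArg strip (h2 p)⟩
    -- Only a chord between the indices 0 and 2 remains, but these have the same level.
    obtain rfl : i = 0 := by omega
    obtain rfl : j = 0 := by omega
    exact step_ne _ _ hl.symm
  key_ne i j hij hj hl hk := by
    match j with
    | 1 =>
      obtain rfl : i = 0 := by omega
      refine step_ne (P.dir 0) (P.lev 0) ?_
      rw [← P.lev_succ 0 (Nat.zero_le _)]
      exact hl
    | j + 2 =>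
      have h1 := P.reachD (i := i) (by omega)
      rw [hl, hk] at h1
      have := P.short (i - 1) (j + 1) (by omega) h1
      omega
  not_bad := hbad
  big_near i hi r r' := by
    obtain ⟨x, hx, hne⟩ := P.lost r'
    have hcont : ∃ p, P.keyD i p = 0 ∧ keyTuple (T.typ (P.levD i + r)) p = x := by
      match i with
      | 0 =>
        obtain ⟨p, hp⟩ := hK 0 (P.levD 0 + r) hx
        exact ⟨p, rfl, hp⟩
      | 1 =>
        obtain ⟨p, hp, hpx⟩ := exists_of_shared hZ (!P.dir 0) (P.lev 1) r hx
        rw [Bool.not_not] at hp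
        refine ⟨p, P.lamD_zero_of_mem hp, ?_⟩
        · rw [show P.levD 1 = P.lev 0 from rfl, P.lev_zero_eq]
          exact hpx
      | i + 2 =>
        obtain ⟨p, hp, hpx⟩ := P.cont (i + 1) (by omega) r x hx
        exact ⟨p, base_eq_zero.2 hp, hpx⟩
    obtain ⟨p, hp, hpx⟩ := hcont
    refine ⟨p, hp, fun p' _ hp' heq => ?_⟩
    rw [P.farD le_rfl] at hp'
    refine hne p' (base_eq_zero.1 hp') ?_
    rw [P.lev_succ _ le_rfl]
    exact heq.symm.trans hpx
  big_far i hi r r' := by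
    obtain ⟨x, hx, hne⟩ := P.lost r'
    have hcont : ∃ p, keyTuple (q.side (!P.dirD i)) p ∈ Schema.key (q.side (P.dirD i)) ∧
        P.lamD i (keyTuple (q.side (!P.dirD i)) p) = 0 ∧
          keyTuple (T.typ (P.levD (i + 1) + r)) p = x := by
      match i with
      | 0 =>
        obtain ⟨p, hp, hpx⟩ := exists_of_shared hZ (!P.dir 0) (P.lev 1) r hx
        refine ⟨p, hp, ?_, ?_⟩
        · rw [Bool.not_not] at hp
          change P.lamD 0 (keyTuple (q.side (!!P.dir 0)) p) = 0
          rw [Bool.not_not, P.lamD_zero_of_mem hp]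
        · rw [show P.levD (0 + 1) = P.lev 0 from rfl, P.lev_zero_eq]
          exact hpx
      | 1 =>
        obtain ⟨p, hp, hpx⟩ := exists_of_shared hZ (P.dir 0) (P.lev 0) r hx
        refine ⟨p, hp, ?_, ?_⟩
        · exact (P.lamD_one_of_mem hp).trans (P.lamD_zero_of_mem ⟨p, rfl⟩)
        · rw [show P.levD (1 + 1) = P.lev 1 from rfl, P.lev_succ 0 (Nat.zero_le _)]
          exact hpx
      | i + 2 =>
        obtain ⟨p, hp, hp0, hpx⟩ := P.cont_far (i + 1) (by omega) r x hx
        exact ⟨p, hp, base_eq_zero.2 hp0, hpx⟩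
    obtain ⟨p, hp, hp0, hpx⟩ := hcont
    refine ⟨p, hp, hp0, fun p' _ hp' heq => ?_⟩
    rw [P.farD le_rfl] at hp'
    refine hne p' (base_eq_zero.1 hp') ?_
    rw [P.lev_succ _ le_rfl]
    exact heq.symm.trans hpx

end ShortPath

/-- A walk exists if some element of the triangle can be lost. -/
theorem exists_walk [Nonempty E] (hdet : q.TwoWayDetermined)
    (hlost : (∀ b b', key (T.typ b) ⊆ key (T.typ b')) → ∃ n s, Reach q n s ∧ T.Lost s) :
    Nonempty (Walk T (Lab (WithZero E))) := by
  by_cases h : ∀ a s, ¬ key (T.typ a) ⊆ T.shared s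
  · exact T.exists_walk_of_not_subset hdet h
  · push Not at h
    obtain ⟨a, s, h⟩ := h
    have hK := T.key_typ_eq h
    obtain ⟨P⟩ := T.exists_shortPath hK (hlost hK)
    by_cases hbad : q.Bad (P.dir 0)
    · refine ⟨P.detour hdet (fun h2 => ?_) hK (T.key_typ_subset_shared h 0)⟩
      obtain ⟨d, hd⟩ := hdet.exists_not_bad
      cases d <;> cases h3 : P.dir 0 <;> simp_all
    · exact ⟨P.walk hbad⟩

end Triangle

/-! ### The triangle and the lost element in a tripath -/

namespace Schema

variable {σ : Schema} {E : Type*} {D : σ.Database E}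

theorem Block.keyTuple_eq (C : Block D) {x y : σ.Term E} (hx : x ∈ C.1) (hy : y ∈ C.1) :
    keyTuple x = keyTuple y := by
  obtain ⟨C, a, ha, rfl⟩ := C
  exact (show KeyEq x a from hx.2).trans (show KeyEq y a from hy.2).symm

theorem Block.eq_of_keyTuple {C C' : Block D} {x y : σ.Term E} (hx : x ∈ C.1) (hy : y ∈ C'.1)
    (h : keyTuple x = keyTuple y) : C = C' := by
  obtain ⟨C, a, ha, rfl⟩ := C
  obtain ⟨C', a', ha', rfl⟩ := C'
  have haa : keyTuple a = keyTuple a' := (Eq.symm hx.2).trans (h.trans hy.2)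
  apply Subtype.ext
  ext c
  simp only [Set.mem_ofPred_eq, KeyEq, haa]

end Schema

namespace Tripath

variable {σ : Schema} {V E : Type*} {q : TwoAtomQuery σ V} {Θ : σ.Database E} (P : Tripath q Θ)

theorem not_leaf_of_parent {B C : Block Θ} (h : P.parent B = some C) :
    C ≠ P.leaf₁ ∧ C ≠ P.leaf₂ :=
  ⟨fun hC => (P.isLeaf_iff C).2 (.inl hC) B h, fun hC => (P.isLeaf_iff C).2 (.inr hC) B h⟩

theorem ne_root_of_parent {B C : Block Θ} (h : P.parent B = some C) : B ≠ P.root := by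
  rintro rfl
  rw [(P.parent_eq_none_iff P.root).2 rfl] at h
  exact absurd h (by simp)

theorem a_mem {B C : Block Θ} (h : P.parent B = some C) : P.a C ∈ C.1 := by
  by_cases hC : C = P.root
  · subst hC
    rw [P.root_eq]
    rfl
  · obtain ⟨h1, h2⟩ := P.not_leaf_of_parent h
    rw [(P.block_eq C hC h1 h2).2]
    exact Set.mem_insert _ _

theorem b_mem {B C : Block Θ} (h : P.parent B = some C) : P.b B ∈ B.1 := by
  by_cases h1 : B = P.leaf₁
  · subst h1
    rw [P.leaf₁_eq]
    rfl
  by_cases h2 : B = P.leaf₂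
  · subst h2
    rw [P.leaf₂_eq]
    rfl
  · rw [(P.block_eq B (P.ne_root_of_parent h) h1 h2).2]
    exact Set.mem_insert_of_mem _ rfl

theorem parent_ne_self (B : Block Θ) : P.parent B ≠ some B := by
  intro h
  have : ∀ C, Relation.ReflTransGen (fun C C' => P.parent C = some C') B C → C = B := by
    intro C hC
    induction hC with
    | refl => rfl
    | tail _ hstep ih =>
      subst ih
      exact Option.some.inj (hstep.symm.trans h)
  exact P.ne_root_of_parent h (this _ (P.reaches_root B)).symm

/-- The center of a triangle-tripath. -/
def triangle (hP : P.IsTriangle) : Triangle q E where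
  tri a := if a = 0 then P.b P.child₁ else if a = 1 then P.a P.center else P.b P.child₂
  sol a := by
    have ha : ∀ a : ZMod 3, a = 0 ∨ a = 1 ∨ a = 2 := by decide
    rcases ha a with rfl | rfl | rfl
    · exact P.sol_de
    · exact P.sol_ef
    · exact hP
  key_inj := by
    have hd := P.b_mem P.parent_child₁
    have he := P.a_mem P.parent_child₁
    have hf := P.b_mem P.parent_child₂
    have h1 : P.child₁ ≠ P.center := fun h =>
      P.parent_ne_self P.center (by rw [← h, P.parent_child₁, h])
    have h2 : P.child₂ ≠ P.center := fun h =>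
      P.parent_ne_self P.center (by rw [← h, P.parent_child₂, h])
    have ha : ∀ a : ZMod 3, a = 0 ∨ a = 1 ∨ a = 2 := by decide
    have e10 : ¬ (1 : ZMod 3) = 0 := by decide
    have e20 : ¬ (2 : ZMod 3) = 0 := by decide
    have e21 : ¬ (2 : ZMod 3) = 1 := by decide
    intro a b hab
    rcases ha a with rfl | rfl | rfl <;> rcases ha b with rfl | rfl | rfl <;>
      simp only [e10, e20, e21, if_true, if_false] at hab
    · rfl
    · exact absurd (Block.eq_of_keyTuple hd he hab) h1
    · exact absurd (Block.eq_of_keyTuple hd hf hab) P.child_ne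
    · exact absurd (Block.eq_of_keyTuple hd he hab.symm) h1
    · rfl
    · exact absurd (Block.eq_of_keyTuple hf he hab.symm) h2
    · exact absurd (Block.eq_of_keyTuple hd hf hab.symm) P.child_ne
    · exact absurd (Block.eq_of_keyTuple hf he hab) h2
    · rfl

end Tripath

namespace Triangle

variable {σ : Schema} {V E : Type*} {q : TwoAtomQuery σ V} (T : Triangle q E)

open Classical in
/-- The key of a fact, with zero in place of the elements that the triangle has there. -/
noncomputable def mark (a : ZMod 3) (x : σ.Term E) (p : Fin σ.keyLen) : WithZero E :=
  if keyTuple x p = keyTuple (T.tri a) p then 0 else ((keyTuple x p : E) : WithZero E)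

theorem mark_congr {a : ZMod 3} {x y : σ.Term E} (h : keyTuple x = keyTuple y) :
    T.mark a x = T.mark a y := by
  unfold mark
  rw [h]

/-- Label by zero the variables where the solution agrees with the triangle's assignment between the
same levels. -/
theorem edge_mark {d : Bool} {x y : σ.Term E} (h : q.DirSol d x y) (a : ZMod 3) :
    Edge q d (a, T.mark a x) (step d a, T.mark (step d a) y) := by
  classical
  obtain ⟨μ, rfl, rfl⟩ := h
  refine ⟨rfl, fun v => if μ v = T.val (idx d a) v then 0 else (μ v : WithZero E), fun p => ?_,
    fun p => ?_⟩
  · have h1 := (T.val_side d a (Fin.castLE σ.keyLen_le p)).1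
    simp only [keyTuple, mark, h1, Function.comp_apply]
    congr
  · have h1 := (T.val_side d a (Fin.castLE σ.keyLen_le p)).2
    simp only [keyTuple, mark, h1, Function.comp_apply]
    congr

theorem lost_mark {a : ZMod 3} {x : σ.Term E} (h : ¬ key (T.tri 0) ⊆ key x) :
    T.Lost (a, T.mark a x) := by
  obtain ⟨_, ⟨p, rfl⟩, hp⟩ := Set.not_subset.1 h
  refine ⟨_, ⟨p, rfl⟩, fun p' hp' heq => hp ⟨p', ?_⟩⟩
  have h1 := congrFun heq 0
  simp only [keyTuple, typ, add_zero] at h1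
  simp only [mark] at hp'
  split_ifs at hp' with h2
  · rw [h2]
    exact h1
  · exact absurd hp' WithZero.coe_ne_zero

theorem key_tri_subset {a b : ZMod 3} (h : key (T.typ a) ⊆ key (T.typ b)) :
    key (T.tri a) ⊆ key (T.tri b) := by
  rintro _ ⟨p, rfl⟩
  obtain ⟨p', hp'⟩ := h ⟨p, rfl⟩
  refine ⟨p', ?_⟩
  have := congrFun hp' 0
  simpa only [keyTuple, typ, add_zero] using this

end Triangle

namespace Tripath

variable {σ : Schema} {V E : Type*} {q : TwoAtomQuery σ V} {Θ : σ.Database E} (P : Tripath q Θ)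

/-- Climb from the branching block, whose mark is zero, to the root; the level follows the direction
of each solution. The condition on the root says that an element of $g(e)$ is lost there. -/
theorem exists_lost (hP : P.IsTriangle)
    (hK : ∀ b b', key ((P.triangle hP).typ b) ⊆ key ((P.triangle hP).typ b')) :
    ∃ n s, Triangle.Reach q n s ∧ (P.triangle hP).Lost s := by
  set T := P.triangle hP with hT
  have key : ∀ C, Relation.ReflTransGen (fun C C' => P.parent C = some C') P.center C →
      (∃ B, P.parent B = some C) ∧
        ∃ n a, Triangle.Reach q n (a, T.mark a (P.a C)) := by
    intro C hC
    induction hC with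
    | refl =>
      refine ⟨⟨_, P.parent_child₁⟩, 0, 1, fun p => ?_⟩
      have : T.tri 1 = P.a P.center := rfl
      simp only [Triangle.mark, this, if_true]
    | @tail C C' _ hstep ih =>
      obtain ⟨⟨B, hB⟩, n, a, hr⟩ := ih
      refine ⟨⟨C, hstep⟩, n + 1, ?_⟩
      rw [T.mark_congr (C.keyTuple_eq (P.a_mem hB) (P.b_mem hstep))] at hr
      have hsol : ∃ d, q.DirSol d (P.b C) (P.a C') := by
        rcases P.edge_sol C' C hstep with h | h
        · exact ⟨false, DirSol.symm (d := true) h⟩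
        · exact ⟨true, h⟩
      obtain ⟨d, hd⟩ := hsol
      exact ⟨step d a, _, hr, d, T.edge_mark hd a⟩
  obtain ⟨-, n, a, hr⟩ := key P.root (P.reaches_root P.center)
  refine ⟨n, _, hr, T.lost_mark ?_⟩
  have hd : T.tri 0 = P.b P.child₁ := rfl
  have he : T.tri 1 = P.a P.center := rfl
  have hf : T.tri 2 = P.b P.child₂ := rfl
  have hde := T.key_tri_subset (hK 0 1)
  have hdf := T.key_tri_subset (hK 0 2)
  have hfe := T.key_tri_subset (hK 2 1)
  have hg := P.g_root
  rw [hd, he] at hde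
  rw [hd, hf] at hdf
  rw [hf, he] at hfe
  -- The three inclusions select the case
  -- $\mathrm{key}(d)\subseteq\mathrm{key}(f)\subseteq\mathrm{key}(e)$, so $g(e)=\mathrm{key}(d)$.
  simp only [gSet, gTuple, hde, hdf, hfe, not_true_eq_false, and_false, false_and, and_self,
    if_true, if_false] at hg
  rw [hd]
  exact hg

end Tripath

/-! ### Embedding the labelled elements into the infinite domain -/

section Cardinality

variable {A B E : Type*} [Infinite E]

theorem nonempty_prod_embedding (hA : Nonempty (A ↪ E)) (hB : Nonempty (B ↪ E)) :
    Nonempty (A × B ↪ E) := by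
  obtain ⟨f⟩ := hA
  obtain ⟨g⟩ := hB
  have h : Cardinal.mk (E × E) = Cardinal.mk E := by
    rw [← Cardinal.mul_def]
    exact Cardinal.mul_eq_self (Cardinal.aleph0_le_mk E)
  obtain ⟨e⟩ := Cardinal.eq.1 h
  exact ⟨(f.prodMap g).trans e.toEmbedding⟩

theorem nonempty_sum_embedding (hA : Nonempty (A ↪ E)) (hB : Nonempty (B ↪ E)) :
    Nonempty (A ⊕ B ↪ E) := by
  obtain ⟨f⟩ := hA
  obtain ⟨g⟩ := hB
  obtain ⟨e⟩ := nonempty_prod_embedding (E := E) ⟨Function.Embedding.refl E⟩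
    ⟨Function.Embedding.refl E⟩
  obtain ⟨x, y, hxy⟩ := exists_pair_ne E
  refine ⟨⟨Sum.elim (fun a => e (x, f a)) (fun b => e (y, g b)), ?_⟩⟩
  rintro (a | a) (b | b) h <;>
    simp_all [hxy.symm]

theorem nonempty_countable_embedding [Countable A] : Nonempty (A ↪ E) := by
  obtain ⟨f, hf⟩ := exists_injective_nat A
  exact ⟨(⟨f, hf⟩ : A ↪ ℕ).trans (Infinite.natEmbedding E)⟩

theorem nonempty_lab_embedding (hA : Nonempty (A ↪ E)) : Nonempty (Lab A ↪ E) :=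
  nonempty_sum_embedding hA nonempty_countable_embedding

theorem nonempty_withZero_embedding : Nonempty (WithZero E ↪ E) := by
  obtain ⟨f⟩ := nonempty_sum_embedding (E := E) ⟨Function.Embedding.refl E⟩
    (nonempty_countable_embedding (A := Unit))
  exact ⟨(Equiv.optionEquivSumPUnit E).toEmbedding.trans f⟩

theorem nonempty_zmod_three_fun_embedding : Nonempty ((ZMod 3 → E) ↪ E) := by
  have hE : Nonempty (E ↪ E) := ⟨Function.Embedding.refl E⟩
  obtain ⟨f⟩ := nonempty_prod_embedding hE (nonempty_prod_embedding hE hE)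
  refine ⟨(⟨fun u => (u 0, u 1, u 2), fun u v h => ?_⟩ : (ZMod 3 → E) ↪ E × E × E).trans f⟩
  simp only [Prod.mk.injEq] at h
  have ha : ∀ a : ZMod 3, a = 0 ∨ a = 1 ∨ a = 2 := by decide
  funext a
  rcases ha a with rfl | rfl | rfl
  exacts [h.1, h.2.1, h.2.2]

theorem nonempty_embedding (E : Type*) [Infinite E] :
    Nonempty (((ZMod 3 → E) × Lab (Lab (WithZero E)) × ZMod 3) × ℕ × ℕ × ℕ ↪ E) :=
  nonempty_prod_embedding
    (nonempty_prod_embedding nonempty_zmod_three_fun_embedding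
      (nonempty_prod_embedding
        (nonempty_lab_embedding (nonempty_lab_embedding nonempty_withZero_embedding))
        nonempty_countable_embedding))
    nonempty_countable_embedding

end Cardinality

theorem mainTheorem7 {V E : Type*} [Infinite E] (σ : Schema) (q : TwoAtomQuery σ V)
    (hdet : q.TwoWayDetermined) (htri : q.AdmitsTriangleTripath E) (k : ℕ) :
    q.certain E ≠ q.Cert k E := by
  obtain ⟨-, Θ, -, P, hP⟩ := htri
  obtain ⟨W⟩ := (P.triangle hP).exists_walk hdet (P.exists_lost hP)
  exact ((W.arm hdet).gadget hdet).certain_ne_cert hdet (nonempty_embedding E) k
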